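/- Let $g,n\ge 1$ and $\Delta\ge 0$ be integers, let $u\ge 1$ be rational, and suppose that $N=gnu+\Delta$ is an integer. The $\Delta$-shifted gnu code (for $\Delta=0$: the gnu code) of length $N$ has the logical codewords $$|0_L\rangle=\sqrt{2^{-(n-1)}}\sum_{\substack{0\le j\le n\\ j\text{ even}}}\sqrt{\tbinom nj}\,|D^N_{gj+\Delta}\rangle,\qquad |1_L\rangle=\sqrt{2^{-(n-1)}}\sum_{\substack{0\le j\le n\\ j\text{ odd}}}\sqrt{\tbinom nj}\,|D^N_{gj+\Delta}\rangle,$$ where $|D^N_w\rangle=\binom Nw^{-1/2}\sum_{x\in\{0,1\}^N,\ x_1+\dots+x_N=w}|x\rangle$. Consider a quantum machine with one qubit that is to be encoded, $N$ code qubits and some auxiliary qubits, the code and auxiliary qubits starting in $|0\rangle$. Each of the following counts as one step: an arbitrary one- or two-qubit gate; a global rotation $U^{\otimes N}$ of the code qubits; a geometric phase gate $\exp\bigl(-i\chi\sin(\varphi+\sum_q\theta_q|1\rangle\langle1|_q)\bigr)$ with real $\chi,\varphi,\theta_q$ ($q$ ranges over the qubits of the machine, $\theta_q=0$ for a qubit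 that is not coupled); a measurement of one qubit in the basis $|0\rangle,|1\rangle$; a gate controlled by the last measurement outcome. Theorem. There is a constant $C$ such that for every gnu or shifted gnu code as above for which $X^{\otimes N}$ is the logical bit-flip, i.e. $X^{\otimes N}|0_L\rangle=|1_L\rangle$ and $X^{\otimes N}|1_L\rangle=|0_L\rangle$, the following holds. With at most $CN$ auxiliary qubits, the state $|0_L\rangle$ of the code qubits can be prepared exactly by at most $CN$ unitary steps, which leave the qubit to be encoded unchanged and return the auxiliary qubits to $|0\rangle$. If these are followed by the gate-teleportation circuit, which has $2N+2$ steps, namely a CNOT from the qubit to be encoded to each code qubit, a Hadamard gate on the qubit to be encoded, its measurement, and, if the outcome is $1$, the gate $R=|0\rangle\langle0|+e^{\pi i/g}|1\rangle\langle1|$ on each code qubit, then every qubit state $a|0\rangle+b|1\rangle$ is encoded into $a|0_L\rangle+b|1_L\rangle$ (for outcome $1$ up to a global phase that does not depend on $a,b$; both outcomes have probability $\tfrac12$). The total number of steps is at most $CN$. -/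

import Mathlib

open scoped BigOperators

noncomputable section

/-! ### Qubits, states, Dicke states and shifted gnu codes -/

/-- (Not necessarily normalised) state vectors of a family of qubits indexed by `Q`: the amplitude
of every computational basis vector `x : Q → Fin 2`. -/
abbrev QState (Q : Type) : Type := (Q → Fin 2) → ℂ

/-- Hamming weight of a bit string. -/
def hammingWt {N : ℕ} (x : Fin N → Fin 2) : ℕ := ∑ i, (x i : ℕ)

/-- The Dicke state of weight `w` on `N` qubits. -/
def dicke (N w : ℕ) : QState (Fin N) := fun x =>
  if hammingWt x = w then ((1 / Real.sqrt (N.choose w : ℝ) : ℝ) : ℂ) else 0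

/-- The part of the codewords of the `Δ`-shifted gnu code of length `N` that comes from
the indices `j` in `0, …, n` with `j % 2 = r`:
`√(2^{-(n-1)}) ∑_{0 ≤ j ≤ n, j ≡ r (mod 2)} √(n choose j) |D^N_{g j + Δ}⟩`. -/
def gnuWord (r g n Δ N : ℕ) : QState (Fin N) :=
  ((Real.sqrt ((2 : ℝ) ^ (-((n : ℤ) - 1))) : ℝ) : ℂ) •
    ∑ j ∈ (Finset.range (n + 1)).filter (fun j => j % 2 = r),
      ((Real.sqrt (n.choose j : ℝ) : ℝ) : ℂ) • dicke N (g * j + Δ)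

/-- Logical `|0_L⟩`: even `j`. -/
def gnuZero (g n Δ N : ℕ) : QState (Fin N) := gnuWord 0 g n Δ N

/-- Logical `|1_L⟩`: odd `j`. -/
def gnuOne (g n Δ N : ℕ) : QState (Fin N) := gnuWord 1 g n Δ N

/-! ### Gates on one and two qubits -/

section Gates

variable {Q : Type} [DecidableEq Q]

/-- A one-qubit operator `U` on qubit `q`, the identity elsewhere. -/
def onQubit (q : Q) (U : Matrix (Fin 2) (Fin 2) ℂ) (ψ : QState Q) : QState Q := fun x =>
  ∑ b, U (x q) b * ψ (Function.update x q b)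

/-- A two-qubit operator `U` on the qubits `q`, `r` (in this order), the identity elsewhere. -/
def onPair (q r : Q) (U : Matrix (Fin 2 × Fin 2) (Fin 2 × Fin 2) ℂ) (ψ : QState Q) : QState Q :=
  fun x => ∑ p : Fin 2 × Fin 2,
    U (x q, x r) p * ψ (Function.update (Function.update x q p.1) r p.2)

/-- The same one-qubit operator on each qubit of a list. -/
def onEach (qs : List Q) (U : Matrix (Fin 2) (Fin 2) ℂ) (ψ : QState Q) : QState Q :=
  qs.foldr (fun q φ => onQubit q U φ) ψ

/-- The unnormalised post-measurement state after qubit `q` was found in the state `|m⟩`. -/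
def projectQubit (q : Q) (m : Fin 2) (ψ : QState Q) : QState Q := fun x =>
  if x q = m then ψ x else 0

/-- The geometric phase gate `exp(-i χ sin(φ + ∑_q θ_q |1⟩⟨1|_q))`, obtained by coupling every
qubit `q` dispersively with strength `θ q` (zero for an uncoupled qubit) to a common bosonic
mode. -/
def geometricPhase [Fintype Q] (θ : Q → ℝ) (φ χ : ℝ) (ψ : QState Q) : QState Q := fun x =>
  Complex.exp (-(Complex.I * ((χ * Real.sin (φ + ∑ q, θ q * ((x q : ℕ) : ℝ)) : ℝ) : ℂ))) * ψ x

end Gates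

/-- The bit-flip `X = |0⟩⟨1| + |1⟩⟨0|`. -/
def pauliX : Matrix (Fin 2) (Fin 2) ℂ := !![0, 1; 1, 0]

/-- The Hadamard matrix `(X + Z) / √2`. -/
def hadamardMat : Matrix (Fin 2) (Fin 2) ℂ :=
  !![(1 / Real.sqrt 2 : ℝ), (1 / Real.sqrt 2 : ℝ); (1 / Real.sqrt 2 : ℝ), -(1 / Real.sqrt 2 : ℝ)]

/-- `R = |0⟩⟨0| + exp(π i / g) |1⟩⟨1|`. -/
def rotMat (g : ℕ) : Matrix (Fin 2) (Fin 2) ℂ :=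
  !![1, 0; 0, Complex.exp (Real.pi * Complex.I / g)]

/-- The CNOT `|c, t⟩ ↦ |c, t + c⟩` (control first). -/
def cnotMat : Matrix (Fin 2 × Fin 2) (Fin 2 × Fin 2) ℂ := fun p q =>
  if p = (q.1, q.2 + q.1) then 1 else 0

theorem hadamardMat_mem : hadamardMat ∈ Matrix.unitaryGroup (Fin 2) ℂ := by
  have h : ((Real.sqrt 2 : ℝ) : ℂ)⁻¹ * ((Real.sqrt 2 : ℝ) : ℂ)⁻¹ = 1 / 2 := by
    rw [← mul_inv, ← Complex.ofReal_mul, Real.mul_self_sqrt (by norm_num)]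
    norm_num
  rw [Matrix.mem_unitaryGroup_iff]
  ext i j
  fin_cases i <;> fin_cases j <;>
    simp [hadamardMat, Matrix.mul_apply, Fin.sum_univ_two, Matrix.star_apply, h] <;> norm_num

theorem rotMat_mem (g : ℕ) : rotMat g ∈ Matrix.unitaryGroup (Fin 2) ℂ := by
  have h : Complex.exp (Real.pi * Complex.I / g) *
      (starRingEnd ℂ) (Complex.exp (Real.pi * Complex.I / g)) = 1 := by
    rw [← Complex.exp_conj, ← Complex.exp_add]
    simp [neg_div]
  rw [Matrix.mem_unitaryGroup_iff]
  ext i j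
  fin_cases i <;> fin_cases j <;>
    simp [rotMat, Matrix.mul_apply, Fin.sum_univ_two, Matrix.star_apply, h]

theorem cnotMat_mem : cnotMat ∈ Matrix.unitaryGroup (Fin 2 × Fin 2) ℂ := by
  rw [Matrix.mem_unitaryGroup_iff]
  ext ⟨i, i'⟩ ⟨j, j'⟩
  fin_cases i <;> fin_cases i' <;> fin_cases j <;> fin_cases j' <;>
    simp [cnotMat, Matrix.mul_apply, Fintype.sum_prod_type, Fin.sum_univ_two, Matrix.star_apply]

/-! ### The machine: one qubit to be encoded, `N` code qubits, `k` auxiliary qubits -/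

/-- The qubits of the machine. -/
abbrev Wire (N k : ℕ) : Type := Unit ⊕ Fin N ⊕ Fin k

/-- The qubit whose state is to be encoded. -/
def encW (N k : ℕ) : Wire N k := Sum.inl ()

/-- The `i`-th code qubit. -/
def codeW {N : ℕ} (k : ℕ) (i : Fin N) : Wire N k := Sum.inr (Sum.inl i)

theorem encW_ne_codeW {N : ℕ} (k : ℕ) (i : Fin N) : encW N k ≠ codeW k i :=
  Sum.inl_ne_inr

/-- The `j`-th auxiliary qubit. -/
def auxW (N : ℕ) {k : ℕ} (j : Fin k) : Wire N k := Sum.inr (Sum.inr j)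

/-- The unitary operations that the machine performs in one step. -/
inductive Gate (N k : ℕ) : Type
  /-- an arbitrary one-qubit gate -/
  | one (q : Wire N k) (U : Matrix.unitaryGroup (Fin 2) ℂ)
  /-- an arbitrary two-qubit gate -/
  | two (q r : Wire N k) (hqr : q ≠ r) (U : Matrix.unitaryGroup (Fin 2 × Fin 2) ℂ)
  /-- a global rotation: the same one-qubit gate on all the code qubits -/
  | global (U : Matrix.unitaryGroup (Fin 2) ℂ)
  /-- a geometric phase gate -/
  | geometric (θ : Wire N k → ℝ) (φ χ : ℝ)

/-- The action of a gate on state vectors. -/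
def Gate.act {N k : ℕ} : Gate N k → QState (Wire N k) → QState (Wire N k)
  | .one q U, ψ => onQubit q U.1 ψ
  | .two q r _ U, ψ => onPair q r U.1 ψ
  | .global U, ψ => onEach ((List.finRange N).map (codeW k)) U.1 ψ
  | .geometric θ φ χ, ψ => geometricPhase θ φ χ ψ

/-- Performing gates one after the other (the head of the list first). -/
def runGates {N k : ℕ} (p : List (Gate N k)) (ψ : QState (Wire N k)) : QState (Wire N k) :=
  p.foldl (fun φ G => G.act φ) ψ

/-- One step of a program: a gate, a measurement of a qubit in the basis `|0⟩, |1⟩`,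
or a gate that is performed if and only if the most recent measurement outcome was `1`. -/
inductive Step (N k : ℕ) : Type
  | gate (G : Gate N k)
  | measure (q : Wire N k)
  | gateIf (G : Gate N k)

/-- The unnormalised final states of a program, one for each sequence of measurement outcomes
(outcome `0` before outcome `1`); the squared norm of a branch is its probability relative to that
of the start.  The number `c` is the most recent measurement outcome, `0` at the start. The number
of steps of a program is the length of the list. -/
def branches {N k : ℕ} : List (Step N k) → Fin 2 → QState (Wire N k) → List (QState (Wire N k))
  | [], _, ψ => [ψ]
  | .gate G :: p, c, ψ => branches p c (G.act ψ)
  | .measure q :: p, _, ψ => branches p 0 (projectQubit q 0 ψ) ++ branches p 1 (projectQubit q 1 ψ)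
  | .gateIf G :: p, c, ψ => branches p c (if c = 1 then G.act ψ else ψ)

/-- The product state: `e` on the qubit to be encoded, `ψ` on the code qubits, `|0⋯0⟩` on the
auxiliary qubits. -/
def machineState {N : ℕ} (k : ℕ) (e : Fin 2 → ℂ) (ψ : QState (Fin N)) : QState (Wire N k) :=
  fun x => e (x (encW N k)) * ψ (fun i => x (codeW k i)) *
    (if ∀ j : Fin k, x (auxW N j) = 0 then 1 else 0)

/-- The basis vector `|0⋯0⟩` of `N` qubits. -/
def allZero (N : ℕ) : QState (Fin N) := fun x => if ∀ i, x i = 0 then 1 else 0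

/-- The gate-teleportation circuit: a CNOT from the qubit to be encoded to each of the code qubits,
a Hadamard gate on the qubit to be encoded and its measurement, and, if the outcome is `1`,
the gate `R` on each of the code qubits. -/
def teleport (g N k : ℕ) : List (Step N k) :=
  (List.finRange N).map (fun i =>
      .gate (.two (encW N k) (codeW k i) (encW_ne_codeW k i) ⟨cnotMat, cnotMat_mem⟩)) ++
    [.gate (.one (encW N k) ⟨hadamardMat, hadamardMat_mem⟩), .measure (encW N k)] ++
    (List.finRange N).map (fun i => .gateIf (.one (codeW k i) ⟨rotMat g, rotMat_mem g⟩))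

end

/-! Three properties of the code matter. The logical zero is a normalised permutation-invariant
state (`sum_normSq_gnuZero`). Flipping all qubits maps it to the logical one. Applying `R` to all
qubits is a logical `Z` up to a phase: with `ω = exp(πi/g)`, weight `gj + Δ` receives `(-1)^j ω^Δ`
(`exp_pow_hammingWt_mul_gnuWord`). The last two give teleportation (`branches_teleport`): the CNOTs
produce `a|0⟩|0_L⟩ + b|1⟩|1_L⟩`, Hadamard and measurement leave `a|0_L⟩ ± b|1_L⟩`, and `R` repairs
the sign. It remains to prepare any normalised permutation-invariant `ψ` with `O(N)` gates
(`exists_runGates_eq_machineState`).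

Geometric phase gates are used in two ways. `M` of them realise exactly any phase depending on an
integer weight below `M` (`exists_runSym_eq_phase`), by interpolation with cosines. A single one
approximates any phase depending on the Hamming weight and the auxiliary string
(`phase_mem_closure_geoPhase`), by a Kronecker-type theorem.

Approximate stage (`exists_mem_closure_reach_normSq_ge`): a one-hot register is put in superposition
according to the weight distribution of `ψ`. For each register value `w`, a product state with
weight-`w` probability at least `1/(N+1)` is amplified by at most `N+1` rounds, all branches running
in parallel under control of the register. The register is then cleared using the weight. With zero
register this leaves at least `1/√2` of every `|ψ c|`; approximating by actual circuits still leaves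
one half.

Exact stage: since the achieved amplitudes dominate `|ψ|/2` and depend only on the weight,
multiplication by a function of modulus at most one makes them equal to `ψ/2`. Such a multiplier is
an average of two exact phases, realised with one flag qubit (`exists_runSym_filter`). Amplitude one
half is `sin(π/6)`, so a single amplification round brings it to one (`exists_runSym_eq_of_half`).
-/

noncomputable section

/-! ### Interpolation and simultaneous approximation by sines of arithmetic progressions -/

/-- The Chebyshev polynomials of the first kind as a polynomial sequence. -/
def chebyshevSequence : Polynomial.Sequence ℝ where
  elems' n := Polynomial.Chebyshev.T ℝ n
  degree_eq' n := by rw [Polynomial.Chebyshev.degree_T]; simp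

theorem chebyshevSequence_apply (n : ℕ) :
    chebyshevSequence n = Polynomial.Chebyshev.T ℝ n := rfl

theorem eval_chebyshevSequence (n : ℕ) (θ : ℝ) :
    (chebyshevSequence n).eval (Real.cos θ) = Real.cos (n * θ) := by
  rw [chebyshevSequence_apply, Polynomial.Chebyshev.T_real_cos]; simp

theorem isUnit_leadingCoeff_chebyshevSequence (n : ℕ) :
    IsUnit (chebyshevSequence n).leadingCoeff := by
  simp

/-- Every function on `{0, …, M - 1}` is a combination of `M` cosines. -/
theorem exists_sum_cos_eq (M : ℕ) (f : ℕ → ℝ) :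
    ∃ χ : ℕ → ℝ, ∀ s < M,
      ∑ i ∈ Finset.range M, χ i * Real.cos (i * (Real.pi / M * s)) = f s := by
  -- The nodes are distinct because cosine is injective on `[0, π]`. The interpolant has degree
  -- below `M`, hence is a combination of the first `M` Chebyshev polynomials, and `T_i(cos θ) =
  -- cos(iθ)`.
  have hinj : Set.InjOn (fun s : ℕ => Real.cos (Real.pi / M * s)) (Finset.range M) := by
    intro a ha b hb hab
    simp only [Finset.coe_range, Set.mem_Iio] at ha hb
    have hM : (0 : ℝ) < M := by exact_mod_cast (Nat.zero_le a).trans_lt ha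
    have hmem : ∀ c : ℕ, c < M → Real.pi / M * c ∈ Set.Icc 0 Real.pi := by
      intro c hc
      have hc' : (c : ℝ) ≤ M := by exact_mod_cast hc.le
      refine ⟨by positivity, ?_⟩
      rw [div_mul_eq_mul_div, div_le_iff₀ hM]
      exact mul_le_mul_of_nonneg_left hc' Real.pi_pos.le
    have h := Real.injOn_cos (hmem a ha) (hmem b hb) hab
    have hne : Real.pi / M ≠ 0 := by positivity
    exact_mod_cast mul_left_cancel₀ hne h
  set P := Lagrange.interpolate (Finset.range M) (fun s : ℕ => Real.cos (Real.pi / M * s)) f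
    with hP
  have hdeg : P ∈ Polynomial.degreeLT ℝ M := by
    rw [Polynomial.mem_degreeLT]
    have h := Lagrange.degree_interpolate_lt f hinj
    rwa [Finset.card_range] at h
  rw [← chebyshevSequence.span_degreeLT (fun i _ => isUnit_leadingCoeff_chebyshevSequence i),
    Finsupp.mem_span_image_iff_linearCombination] at hdeg
  obtain ⟨l, hl, hlP⟩ := hdeg
  refine ⟨l, fun s hs => ?_⟩
  have hev := Lagrange.eval_interpolate_at_node f hinj (Finset.mem_range.2 hs)
  rw [← hP, ← hlP, Finsupp.linearCombination_apply,
    Finsupp.sum_of_support_subset l (s := Finset.range M) _ _ (by simp)] at hev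
  · rw [← hev, Polynomial.eval_finsetSum]
    refine Finset.sum_congr rfl fun i _ => ?_
    rw [Polynomial.eval_smul, eval_chebyshevSequence, smul_eq_mul]
  · intro i hi
    have := hl hi
    simpa using this

/-- Digit expansion: the multiples of one number by powers of `q` can be prescribed modulo one
up to an error `1 / q`. -/
theorem exists_powers_near_mod_one (q : ℕ) (hq : 1 ≤ q) (M : ℕ) (σ : ℕ → ℝ) :
    ∃ r : ℝ, 0 ≤ r ∧ r < 1 ∧ ∀ i < M, ∃ m : ℤ, |(q : ℝ) ^ i * r - σ i - m| ≤ 1 / q := by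
  induction M generalizing σ with
  | zero => exact ⟨0, le_rfl, one_pos, by simp⟩
  | succ M ih =>
    -- The number is written in base `q`: its first digit `d` is that of the fractional part of `σ
    -- 0`, and its tail `r` serves the shifted targets.
    obtain ⟨r, hr0, hr1, hr⟩ := ih (fun i => σ (i + 1))
    have hq0 : (0 : ℝ) < q := by exact_mod_cast hq
    set x := Int.fract (σ 0) with hx
    set d := ⌊(q : ℝ) * x⌋ with hd
    have hx0 : 0 ≤ x := Int.fract_nonneg _
    have hx1 : x < 1 := Int.fract_lt_one _
    have hd0 : 0 ≤ d := Int.floor_nonneg.2 (by positivity)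
    have hd1 : (d : ℝ) ≤ q * x := Int.floor_le _
    have hd2 : (q : ℝ) * x < d + 1 := Int.lt_floor_add_one _
    have hdq : d + 1 ≤ q := by
      have : (d : ℝ) < q := by nlinarith
      have : d < (q : ℤ) := by exact_mod_cast this
      omega
    have hdq' : (d : ℝ) + 1 ≤ q := by exact_mod_cast hdq
    have hd0' : (0 : ℝ) ≤ d := by exact_mod_cast hd0
    refine ⟨(d + r) / q, by positivity, by rw [div_lt_one hq0]; linarith, ?_⟩
    rintro (_ | i) hi
    · refine ⟨-⌊σ 0⌋, ?_⟩
      have hσ : σ 0 = ⌊σ 0⌋ + x := (Int.floor_add_fract _).symm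
      have : (q : ℝ) ^ 0 * ((d + r) / q) - σ 0 - ((-⌊σ 0⌋ : ℤ) : ℝ) = (d + r - q * x) / q := by
        push_cast
        rw [sub_eq_iff_eq_add, sub_eq_iff_eq_add, hσ]
        simp only [Int.floor_intCast_add, Int.cast_add]
        field_simp
        have : ⌊x⌋ = 0 := by rw [hx]; exact Int.floor_fract _
        rw [this]; push_cast; ring
      rw [this, abs_div, abs_of_pos hq0]
      refine div_le_div_of_nonneg_right ?_ hq0.le
      rw [abs_le]; constructor <;> linarith
    · obtain ⟨m, hm⟩ := hr i (by omega)
      refine ⟨m + (q : ℤ) ^ i * d, ?_⟩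
      convert hm using 2
      push_cast
      field_simp
      ring

/-- Kronecker's theorem for cosines of an arithmetic progression: they can be multiplied by one
number so as to approximate arbitrary angles. -/
theorem exists_mul_cos_near (M : ℕ) (τ : ℕ → ℝ) (ε : ℝ) (hε : 0 < ε) :
    ∃ χ θ : ℝ, ∀ s < M, ∃ m : ℤ, |χ * Real.cos (s * θ) - τ s - m * (2 * Real.pi)| < ε := by
  -- The functional `ℓ` takes the value `τ s / 2π` at `T_s`. With `cos θ = 1/q` and `χ = 2π q^(M-1)
  -- r`, the number `χ cos(sθ) / 2π` is the sum of `a s j * q^(M-1-j) r` over `j`. The coefficients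
  -- `a s j` are integers, so it suffices that `q^(M-1-j) r` is near `ℓ(X^j)` modulo one; the total
  -- error is at most `K/q`.
  set b := chebyshevSequence.basis isUnit_leadingCoeff_chebyshevSequence
  set ℓ : Polynomial ℝ →ₗ[ℝ] ℝ := b.constr ℝ (fun s => τ s / (2 * Real.pi)) with hℓdef
  have hℓ : ∀ s : ℕ, ℓ (chebyshevSequence s) = τ s / (2 * Real.pi) := by
    intro s
    have h := b.constr_basis ℝ (fun s => τ s / (2 * Real.pi)) s
    rwa [Polynomial.Sequence.basis_eq_self] at h
  set a : ℕ → ℕ → ℤ := fun s j => (Polynomial.Chebyshev.T ℤ s).coeff j with ha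
  have hcoeff : ∀ s j, (chebyshevSequence s).coeff j = a s j := by
    intro s j
    rw [chebyshevSequence_apply, ha, ← Polynomial.Chebyshev.map_T (Int.castRingHom ℝ),
      Polynomial.coeff_map]
    rfl
  set K : ℝ := ∑ s ∈ Finset.range M, ∑ j ∈ Finset.range M, |(a s j : ℝ)| with hK
  have hK0 : 0 ≤ K := by positivity
  obtain ⟨q, hq⟩ := exists_nat_gt (max 1 (2 * Real.pi * K / ε))
  have hq1 : (1 : ℝ) < q := (le_max_left _ _).trans_lt hq
  have hq2 : 2 * Real.pi * K / ε < q := (le_max_right _ _).trans_lt hq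
  have hq0 : (0 : ℝ) < q := by linarith
  obtain ⟨r, -, -, hr⟩ := exists_powers_near_mod_one q (by exact_mod_cast hq1.le) M
    (fun i => ℓ (Polynomial.X ^ (M - 1 - i)))
  refine ⟨2 * Real.pi * (q ^ (M - 1) * r), Real.arccos (1 / q), fun s hs => ?_⟩
  have hcos : Real.cos (s * Real.arccos (1 / q)) =
      ∑ j ∈ Finset.range M, (a s j : ℝ) * (1 / q) ^ j := by
    have h1 : (1 : ℝ) / q ≤ 1 := by rw [div_le_one hq0]; exact hq1.le
    have h0 : (0 : ℝ) ≤ 1 / q := by positivity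
    rw [← eval_chebyshevSequence, Real.cos_arccos (by linarith) h1,
      Polynomial.eval_eq_sum_range' (n := M) (by simpa using hs)]
    simp only [hcoeff]
  have hτ : τ s / (2 * Real.pi) = ∑ j ∈ Finset.range M, (a s j : ℝ) * ℓ (Polynomial.X ^ j) := by
    rw [← hℓ]
    conv_lhs => rw [(chebyshevSequence s).as_sum_range' M (by simpa using hs)]
    rw [map_sum]
    refine Finset.sum_congr rfl fun j _ => ?_
    rw [hcoeff, ← Polynomial.smul_X_eq_monomial, map_smul, smul_eq_mul]
  have hex : ∀ j ∈ Finset.range M, ∃ m : ℤ,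
      |(q : ℝ) ^ (M - 1) * r * (1 / q) ^ j - ℓ (Polynomial.X ^ j) - m| ≤ 1 / q := by
    intro j hj
    rw [Finset.mem_range] at hj
    obtain ⟨m, hm⟩ := hr (M - 1 - j) (by omega)
    refine ⟨m, ?_⟩
    rw [show M - 1 - (M - 1 - j) = j by omega] at hm
    have : (q : ℝ) ^ (M - 1) * r * (1 / q) ^ j = q ^ (M - 1 - j) * r := by
      rw [show M - 1 = (M - 1 - j) + j by omega, pow_add, Nat.add_sub_cancel, one_div, inv_pow]
      field_simp
    rwa [this]
  choose! m hm using hex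
  refine ⟨∑ j ∈ Finset.range M, a s j * m j, ?_⟩
  have hτ' : τ s = 2 * Real.pi * ∑ j ∈ Finset.range M, (a s j : ℝ) * ℓ (Polynomial.X ^ j) := by
    rw [← hτ]; field_simp
  have hrw : 2 * Real.pi * (q ^ (M - 1) * r) * Real.cos (s * Real.arccos (1 / q)) - τ s -
      ((∑ j ∈ Finset.range M, a s j * m j : ℤ) : ℝ) * (2 * Real.pi) =
      2 * Real.pi * ∑ j ∈ Finset.range M, (a s j : ℝ) *
        ((q : ℝ) ^ (M - 1) * r * (1 / q) ^ j - ℓ (Polynomial.X ^ j) - m j) := by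
    rw [hcos, hτ']
    push_cast
    simp only [mul_sub, Finset.sum_sub_distrib, Finset.mul_sum, Finset.sum_mul]
    congr 1
    · congr 1
      exact Finset.sum_congr rfl fun j _ => by ring
    · exact Finset.sum_congr rfl fun j _ => by ring
  rw [hrw, abs_mul, abs_of_pos (by positivity : (0 : ℝ) < 2 * Real.pi)]
  have hle : |∑ j ∈ Finset.range M, (a s j : ℝ) *
        ((q : ℝ) ^ (M - 1) * r * (1 / q) ^ j - ℓ (Polynomial.X ^ j) - m j)| ≤ K * (1 / q) := by
    refine (Finset.abs_sum_le_sum_abs _ _).trans ?_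
    calc _ ≤ ∑ j ∈ Finset.range M, |(a s j : ℝ)| * (1 / q) := by
          refine Finset.sum_le_sum fun j hj => ?_
          rw [abs_mul]
          exact mul_le_mul_of_nonneg_left (hm j hj) (abs_nonneg _)
      _ ≤ K * (1 / q) := by
          rw [← Finset.sum_mul]
          refine mul_le_mul_of_nonneg_right ?_ (by positivity)
          exact Finset.single_le_sum
            (f := fun s => ∑ j ∈ Finset.range M, |(a s j : ℝ)|)
            (fun i _ => by positivity) (Finset.mem_range.2 hs)
  calc _ ≤ 2 * Real.pi * (K * (1 / q)) := mul_le_mul_of_nonneg_left hle (by positivity)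
    _ = 2 * Real.pi * K / q := by ring
    _ < ε := by
      rw [div_lt_iff₀ hε] at hq2
      rw [div_lt_iff₀ hq0]
      linarith

/-! ### One-qubit operators and their kernels -/

/-- The scalar product of two state vectors. -/
def braket {α : Type*} [Fintype α] (φ ψ : α → ℂ) : ℂ := ∑ x, star (φ x) * ψ x

section Qubits

variable {Q : Type} [DecidableEq Q]

theorem onQubit_onQubit (q : Q) (U V : Matrix (Fin 2) (Fin 2) ℂ) (ψ : QState Q) :
    onQubit q U (onQubit q V ψ) = onQubit q (U * V) ψ := by
  funext x
  simp only [onQubit, Matrix.mul_apply, Finset.sum_mul, Finset.mul_sum, Function.update_self,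
    Function.update_idem]
  rw [Finset.sum_comm]
  simp only [mul_assoc]

theorem onQubit_one (q : Q) (ψ : QState Q) : onQubit q 1 ψ = ψ := by
  funext x
  simp [onQubit, Matrix.one_apply]

theorem braket_onQubit [Fintype Q] (q : Q) (U : Matrix (Fin 2) (Fin 2) ℂ) (φ ψ : QState Q) :
    braket φ (onQubit q U ψ) = braket (onQubit q (star U) φ) ψ := by
  simp only [braket, onQubit, star_sum, Finset.sum_mul, Finset.mul_sum]
  rw [← Fintype.sum_prod_type', ← Fintype.sum_prod_type']
  -- The involution exchanges the bit that is read with the bit that is written.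
  refine Finset.sum_nbij' (fun p => (Function.update p.1 q p.2, p.1 q))
    (fun p => (Function.update p.1 q p.2, p.1 q)) ?_ ?_ ?_ ?_ ?_ <;> simp
  exact fun x => ⟨by ring, by ring⟩

theorem continuous_onQubit (q : Q) (U : Matrix (Fin 2) (Fin 2) ℂ) :
    Continuous (onQubit q U) := by
  unfold onQubit
  fun_prop

theorem onEach_apply_of_nodup [Fintype Q] (U : Matrix (Fin 2) (Fin 2) ℂ) (qs : List Q)
    (hqs : qs.Nodup) (ψ : QState Q) (x : Q → Fin 2) :
    onEach qs U ψ x =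
      ∑ b : Q → Fin 2, (if ∀ i, i ∉ qs → b i = x i then ∏ i ∈ qs.toFinset, U (x i) (b i) else 0)
        * ψ b := by
  induction qs generalizing x with
  | nil =>
    have : ∀ b : Q → Fin 2, (∀ i, b i = x i) ↔ b = x := fun b => funext_iff.symm
    simp [onEach, this]
  | cons q qs ih =>
    obtain ⟨hq, hqs⟩ := List.nodup_cons.1 hqs
    change onQubit q U (onEach qs U ψ) x = _
    simp only [onQubit, ih hqs, Finset.mul_sum]
    rw [Finset.sum_comm]
    refine Finset.sum_congr rfl fun b _ => ?_
    have hcond : ∀ d : Fin 2, (∀ i, i ∉ qs → b i = Function.update x q d i) ↔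
        (d = b q ∧ ∀ i, i ∉ q :: qs → b i = x i) := by
      intro d
      constructor
      · intro h
        refine ⟨by simpa using (h q hq).symm, fun i hi => ?_⟩
        simp only [List.mem_cons, not_or] at hi
        simpa [hi.1] using h i hi.2
      · rintro ⟨rfl, h⟩ i hi
        rcases eq_or_ne i q with rfl | hiq
        · simp
        · simpa [hiq] using h i (by simp [hiq, hi])
    have hprod : ∀ d : Fin 2, ∏ i ∈ qs.toFinset, U (Function.update x q d i) (b i) =
        ∏ i ∈ qs.toFinset, U (x i) (b i) := by
      intro d
      refine Finset.prod_congr rfl fun i hi => ?_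
      rw [Function.update_of_ne]
      rintro rfl
      exact hq (by simpa using hi)
    simp only [hcond, hprod]
    rw [Finset.sum_eq_single (b q) (by intro d _ hd; simp [hd]) (by simp)]
    by_cases h : ∀ i, i ∉ q :: qs → b i = x i
    · rw [if_pos ⟨rfl, h⟩, if_pos h, List.toFinset_cons, Finset.prod_insert (by simpa using hq)]
      ring
    · rw [if_neg h, if_neg (fun h' => h h'.2)]
      ring

end Qubits

section Code

variable {N : ℕ}

theorem onEach_finRange_apply (U : Matrix (Fin 2) (Fin 2) ℂ) (ψ : QState (Fin N))
    (x : Fin N → Fin 2) :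
    onEach (List.finRange N) U ψ x = ∑ b : Fin N → Fin 2, (∏ i, U (x i) (b i)) * ψ b := by
  rw [onEach_apply_of_nodup U _ (List.nodup_finRange N)]
  simp

theorem onEach_mul (U V : Matrix (Fin 2) (Fin 2) ℂ) (ψ : QState (Fin N)) :
    onEach (List.finRange N) U (onEach (List.finRange N) V ψ) =
      onEach (List.finRange N) (U * V) ψ := by
  funext x
  simp only [onEach_finRange_apply, Finset.mul_sum]
  rw [Finset.sum_comm]
  refine Finset.sum_congr rfl fun b _ => ?_
  simp only [Matrix.mul_apply]
  rw [Finset.prod_univ_sum, Fintype.piFinset_univ, Finset.sum_mul]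
  refine Finset.sum_congr rfl fun d _ => ?_
  rw [Finset.prod_mul_distrib, mul_assoc]

theorem onEach_one (ψ : QState (Fin N)) : onEach (List.finRange N) 1 ψ = ψ := by
  generalize List.finRange N = l
  induction l with
  | nil => rfl
  | cons q l ih =>
    change onQubit q 1 (onEach l 1 ψ) = ψ
    rw [ih, onQubit_one]

theorem braket_onEach (U : Matrix (Fin 2) (Fin 2) ℂ) (φ ψ : QState (Fin N)) :
    braket φ (onEach (List.finRange N) U ψ) = braket (onEach (List.finRange N) (star U) φ) ψ := by
  simp only [braket, onEach_finRange_apply, star_sum, Finset.sum_mul, Finset.mul_sum]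
  rw [Finset.sum_comm]
  refine Finset.sum_congr rfl fun b _ => Finset.sum_congr rfl fun d _ => ?_
  simp only [star_mul', star_prod, Matrix.star_apply, star_star]
  ring

theorem onEach_prod (U : Matrix (Fin 2) (Fin 2) ℂ) (f : Fin N → Fin 2 → ℂ) :
    onEach (List.finRange N) U (fun x => ∏ i, f i (x i)) =
      fun x => ∏ i, ∑ b, U (x i) b * f i b := by
  funext x
  rw [onEach_finRange_apply, Finset.prod_univ_sum, Fintype.piFinset_univ]
  simp only [Finset.prod_mul_distrib]

theorem onEach_comp_perm (U : Matrix (Fin 2) (Fin 2) ℂ) (ψ : QState (Fin N))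
    (σ : Equiv.Perm (Fin N)) (x : Fin N → Fin 2) :
    onEach (List.finRange N) U ψ (x ∘ σ) =
      onEach (List.finRange N) U (fun y => ψ (y ∘ σ)) x := by
  rw [onEach_finRange_apply, onEach_finRange_apply]
  refine Fintype.sum_equiv (σ.arrowCongr (Equiv.refl _)) _ _ fun b => ?_
  congr 1
  · refine Fintype.prod_equiv σ _ _ fun i => ?_
    simp [Equiv.arrowCongr]
  · congr 1
    funext i
    simp [Equiv.arrowCongr]

theorem onEach_pauliX (ψ : QState (Fin N)) (x : Fin N → Fin 2) :
    onEach (List.finRange N) pauliX ψ x = ψ (fun i => x i + 1) := by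
  rw [onEach_finRange_apply, Finset.sum_eq_single (fun i => x i + 1)]
  · have h : ∀ b : Fin 2, pauliX b (b + 1) = 1 := by
      intro b; fin_cases b <;> simp [pauliX]
    simp [h]
  · intro b _ hb
    obtain ⟨i, hi⟩ := Function.ne_iff.1 hb
    have h : ∀ b c : Fin 2, c ≠ b + 1 → pauliX b c = 0 := by
      intro b c; fin_cases b <;> fin_cases c <;> simp [pauliX]
    rw [Finset.prod_eq_zero (Finset.mem_univ i) (h _ _ hi), zero_mul]
  · simp

/-! ### Hamming weights -/

theorem hammingWt_eq_card (x : Fin N → Fin 2) :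
    hammingWt x = (Finset.univ.filter fun i => x i = 1).card := by
  rw [hammingWt, Finset.card_filter]
  refine Finset.sum_congr rfl fun i _ => ?_
  generalize x i = b
  fin_cases b <;> simp

theorem hammingWt_le (x : Fin N → Fin 2) : hammingWt x ≤ N := by
  rw [hammingWt_eq_card]
  exact (Finset.card_le_univ _).trans (by simp)

theorem hammingWt_comp_perm (σ : Equiv.Perm (Fin N)) (x : Fin N → Fin 2) :
    hammingWt (x ∘ σ) = hammingWt x := by
  exact Fintype.sum_equiv σ _ _ fun i => rfl

theorem hammingWt_eq_zero (x : Fin N → Fin 2) : hammingWt x = 0 ↔ ∀ i, x i = 0 := by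
  simp [hammingWt, Finset.sum_eq_zero_iff]

/-- The fibres over 0 and over 1 have equal sizes for both strings, so bijections between the fibres
glue to a permutation. -/
theorem exists_perm_of_hammingWt_eq {x y : Fin N → Fin 2} (h : hammingWt x = hammingWt y) :
    ∃ σ : Equiv.Perm (Fin N), x ∘ σ = y := by
  have h1 : (Finset.univ.filter fun i => y i = 1).card =
      (Finset.univ.filter fun i => x i = 1).card := by
    rw [← hammingWt_eq_card, ← hammingWt_eq_card, h]
  have h0 : (Finset.univ.filter fun i => y i = 0).card =
      (Finset.univ.filter fun i => x i = 0).card := by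
    have key : ∀ z : Fin N → Fin 2, (Finset.univ.filter fun i => z i = 0).card =
        N - (Finset.univ.filter fun i => z i = 1).card := by
      intro z
      have := Finset.card_filter_add_card_filter_not (s := (Finset.univ : Finset (Fin N)))
        (p := fun i => z i = 1)
      have hnot : ∀ i, (¬ z i = 1) ↔ z i = 0 := by
        intro i; generalize z i = b; fin_cases b <;> simp
      simp only [hnot, Finset.card_univ, Fintype.card_fin] at this
      omega
    rw [key, key, h1]
  have hf : ∀ b : Fin 2, Nonempty ({i // y i = b} ≃ {i // x i = b}) := by
    intro b
    refine ⟨Fintype.equivOfCardEq ?_⟩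
    rw [Fintype.card_subtype, Fintype.card_subtype]
    fin_cases b
    · exact h0
    · exact h1
  let e : ∀ b : Fin 2, {i // y i = b} ≃ {i // x i = b} := fun b => (hf b).some
  refine ⟨(Equiv.sigmaFiberEquiv y).symm.trans
    ((Equiv.sigmaCongrRight e).trans (Equiv.sigmaFiberEquiv x)), ?_⟩
  funext i
  exact (e (y i) ⟨i, rfl⟩).2

theorem card_hammingWt_eq (w : ℕ) :
    (Finset.univ.filter fun x : Fin N → Fin 2 => hammingWt x = w).card = N.choose w := by
  have hcard : ((Finset.univ : Finset (Fin N)).powersetCard w).card = N.choose w := by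
    simp
  rw [← hcard]
  refine Finset.card_nbij' (fun x => Finset.univ.filter fun i => x i = 1)
    (fun s i => if i ∈ s then 1 else 0) ?_ ?_ ?_ ?_
  · intro x hx
    simp only [Finset.coe_filter, Finset.mem_univ, true_and, Set.mem_ofPred_eq] at hx
    simp [Finset.mem_powersetCard, ← hammingWt_eq_card, hx]
  · intro s hs
    have := (Finset.mem_powersetCard.1 hs).2
    simp [hammingWt_eq_card, this]
  · intro x _
    funext i
    generalize hb : x i = b
    fin_cases b <;> simp [hb]
  · intro s _
    ext i
    simp

end Code

/-! ### Permutation-covariant gates on code and auxiliary qubits -/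

/-- State vectors of the `N` code qubits (first argument) and `k` auxiliary qubits (second
argument). -/
abbrev RegState (N k : ℕ) : Type := (Fin N → Fin 2) → (Fin k → Fin 2) → ℂ

/-- The state of the machine with `e` on the qubit to be encoded and `Φ` elsewhere. -/
def withEnc {N k : ℕ} (e : Fin 2 → ℂ) (Φ : RegState N k) : QState (Wire N k) := fun x =>
  e (x (encW N k)) * Φ (fun i => x (codeW k i)) (fun j => x (auxW N j))

/-- The auxiliary qubits in `|0⋯0⟩`. -/
def withZeroAux {N : ℕ} (k : ℕ) (ψ : QState (Fin N)) : RegState N k := fun c a =>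
  if a = 0 then ψ c else 0

/-- Gates of the machine that ignore the qubit to be encoded and treat all code qubits alike. -/
inductive SymGate (N k : ℕ) : Type
  | aux (j : Fin k) (U : Matrix.unitaryGroup (Fin 2) ℂ)
  | global (U : Matrix.unitaryGroup (Fin 2) ℂ)
  | geometric (t : ℝ) (θ : Fin k → ℝ) (φ χ : ℝ)

section SymGate

variable {N k : ℕ}

/-- The phase that a geometric phase gate gives to a basis vector. -/
def geoPhase (t : ℝ) (θ : Fin k → ℝ) (φ χ : ℝ) (c : Fin N → Fin 2) (a : Fin k → Fin 2) : ℂ :=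
  Complex.exp (-(Complex.I * ((χ * Real.sin (φ + (t * (hammingWt c : ℝ) +
    ∑ j, θ j * ((a j : ℕ) : ℝ))) : ℝ) : ℂ)))

/-- The action of a symmetric gate. -/
def SymGate.act : SymGate N k → RegState N k → RegState N k
  | .aux j U, Φ => fun c => onQubit j U.1 (Φ c)
  | .global U, Φ => fun c a => onEach (List.finRange N) U.1 (fun c' => Φ c' a) c
  | .geometric t θ φ χ, Φ => fun c a => geoPhase t θ φ χ c a * Φ c a

/-- Symmetric gates as gates of the machine. -/
def SymGate.toGate : SymGate N k → Gate N k
  | .aux j U => .one (auxW N j) U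
  | .global U => .global U
  | .geometric t θ φ χ => .geometric (Sum.elim 0 (Sum.elim (fun _ => t) θ)) φ χ

/-- The inverse gate. -/
def SymGate.inv : SymGate N k → SymGate N k
  | .aux j U => .aux j U⁻¹
  | .global U => .global U⁻¹
  | .geometric t θ φ χ => .geometric t θ φ (-χ)

/-- Performing symmetric gates one after the other. -/
def runSym (p : List (SymGate N k)) (Φ : RegState N k) : RegState N k :=
  p.foldl (fun Φ G => G.act Φ) Φ

theorem runSym_append (p q : List (SymGate N k)) (Φ : RegState N k) :
    runSym (p ++ q) Φ = runSym q (runSym p Φ) := by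
  simp [runSym]

theorem runSym_cons (G : SymGate N k) (p : List (SymGate N k)) (Φ : RegState N k) :
    runSym (G :: p) Φ = runSym p (G.act Φ) := rfl

theorem machineState_eq_withEnc (e : Fin 2 → ℂ) (ψ : QState (Fin N)) :
    machineState k e ψ = withEnc e (withZeroAux k ψ) := by
  funext x
  simp [machineState, withEnc, withZeroAux, funext_iff]

theorem onQubit_auxW_withEnc (j : Fin k) (U : Matrix (Fin 2) (Fin 2) ℂ) (e : Fin 2 → ℂ)
    (Φ : RegState N k) :
    onQubit (auxW N j) U (withEnc e Φ) = withEnc e (fun c => onQubit j U (Φ c)) := by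
  funext x
  simp only [onQubit, withEnc, Finset.mul_sum]
  refine Finset.sum_congr rfl fun b _ => ?_
  have h1 : Function.update x (auxW N j) b (encW N k) = x (encW N k) :=
    Function.update_of_ne (by simp [encW, auxW]) _ _
  have h2 : (fun i : Fin N => Function.update x (auxW N j) b (codeW k i)) =
      fun i => x (codeW k i) :=
    funext fun i => Function.update_of_ne (by simp [codeW, auxW]) _ _
  have h3 : (fun i : Fin k => Function.update x (auxW N j) b (auxW N i)) =
      Function.update (fun i => x (auxW N i)) j b := by
    funext i
    simp [Function.update_apply, auxW]
  rw [h1, h2, h3]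
  ring

theorem onQubit_codeW_withEnc (i : Fin N) (U : Matrix (Fin 2) (Fin 2) ℂ) (e : Fin 2 → ℂ)
    (Φ : RegState N k) :
    onQubit (codeW k i) U (withEnc e Φ) =
      withEnc e (fun c a => onQubit i U (fun c' => Φ c' a) c) := by
  funext x
  simp only [onQubit, withEnc, Finset.mul_sum]
  refine Finset.sum_congr rfl fun b _ => ?_
  have h1 : Function.update x (codeW k i) b (encW N k) = x (encW N k) :=
    Function.update_of_ne (by simp [encW, codeW]) _ _
  have h2 : (fun j : Fin k => Function.update x (codeW k i) b (auxW N j)) =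
      fun j => x (auxW N j) :=
    funext fun j => Function.update_of_ne (by simp [codeW, auxW]) _ _
  have h3 : (fun j : Fin N => Function.update x (codeW k i) b (codeW k j)) =
      Function.update (fun j => x (codeW k j)) i b := by
    funext j
    simp [Function.update_apply, codeW]
  rw [h1, h2, h3]
  ring

theorem onEach_codeW_withEnc (l : List (Fin N)) (U : Matrix (Fin 2) (Fin 2) ℂ) (e : Fin 2 → ℂ)
    (Φ : RegState N k) :
    onEach (l.map (codeW k)) U (withEnc e Φ) =
      withEnc e (fun c a => onEach l U (fun c' => Φ c' a) c) := by
  induction l with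
  | nil => rfl
  | cons i l ih =>
    change onQubit (codeW k i) U (onEach (l.map (codeW k)) U (withEnc e Φ)) = _
    rw [ih, onQubit_codeW_withEnc]
    rfl

/-- Symmetric gates do not couple to the qubit to be encoded, so the whole preparation can be
studied on `RegState`. -/
theorem SymGate.toGate_act (G : SymGate N k) (e : Fin 2 → ℂ) (Φ : RegState N k) :
    G.toGate.act (withEnc e Φ) = withEnc e (G.act Φ) := by
  cases G with
  | aux j U => exact onQubit_auxW_withEnc j U.1 e Φ
  | global U => exact onEach_codeW_withEnc _ U.1 e Φ
  | geometric t θ φ χ =>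
    funext x
    simp only [SymGate.toGate, Gate.act, geometricPhase, withEnc, SymGate.act, geoPhase]
    have : ∑ q : Wire N k, (Sum.elim 0 (Sum.elim (fun _ => t) θ) : Wire N k → ℝ) q *
        ((x q : ℕ) : ℝ) = t * (hammingWt (fun i => x (codeW k i)) : ℝ) +
          ∑ j, θ j * ((x (auxW N j) : ℕ) : ℝ) := by
      rw [Fintype.sum_sum_type, Fintype.sum_sum_type]
      simp [hammingWt, Finset.mul_sum, codeW, auxW]
    rw [this]
    ring

theorem runGates_map_toGate (p : List (SymGate N k)) (e : Fin 2 → ℂ) (Φ : RegState N k) :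
    runGates (p.map SymGate.toGate) (withEnc e Φ) = withEnc e (runSym p Φ) := by
  induction p generalizing Φ with
  | nil => rfl
  | cons G p ih =>
    change runGates (p.map SymGate.toGate) (G.toGate.act (withEnc e Φ)) = _
    rw [SymGate.toGate_act, ih]
    rfl

/-! ### Inverses and unitarity of symmetric gates -/

theorem star_geoPhase (t : ℝ) (θ : Fin k → ℝ) (φ χ : ℝ) (c : Fin N → Fin 2)
    (a : Fin k → Fin 2) : star (geoPhase t θ φ χ c a) = geoPhase t θ φ (-χ) c a := by
  simp only [geoPhase, Complex.star_def, ← Complex.exp_conj, map_neg, map_mul, Complex.conj_I,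
    Complex.conj_ofReal]
  congr 1
  push_cast
  ring

theorem geoPhase_mul_geoPhase_neg (t : ℝ) (θ : Fin k → ℝ) (φ χ : ℝ) (c : Fin N → Fin 2)
    (a : Fin k → Fin 2) : geoPhase t θ φ χ c a * geoPhase t θ φ (-χ) c a = 1 := by
  simp only [geoPhase, ← Complex.exp_add]
  rw [← Complex.exp_zero]
  congr 1
  push_cast
  ring

theorem unitary_mul_inv_val (U : Matrix.unitaryGroup (Fin 2) ℂ) : U.1 * (U⁻¹).1 = 1 := by
  have h : U * U⁻¹ = 1 := mul_inv_cancel U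
  exact congrArg Subtype.val h

theorem SymGate.act_inv_act (G : SymGate N k) (Φ : RegState N k) : G.act (G.inv.act Φ) = Φ := by
  cases G with
  | aux j U =>
    funext c
    simp only [SymGate.inv, SymGate.act, onQubit_onQubit, unitary_mul_inv_val, onQubit_one]
  | global U =>
    funext c a
    simp only [SymGate.inv, SymGate.act, onEach_mul, unitary_mul_inv_val, onEach_one]
  | geometric t θ φ χ =>
    funext c a
    simp only [SymGate.inv, SymGate.act]
    rw [← mul_assoc, geoPhase_mul_geoPhase_neg, one_mul]

theorem SymGate.inv_inv (G : SymGate N k) : G.inv.inv = G := by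
  cases G <;> simp [SymGate.inv]

/-- The scalar product of states of code and auxiliary qubits. -/
def regBraket (Φ Ψ : RegState N k) : ℂ := ∑ c, braket (Φ c) (Ψ c)

theorem regBraket_eq_sum_slices (Φ Ψ : RegState N k) :
    regBraket Φ Ψ = ∑ a, braket (fun c => Φ c a) (fun c => Ψ c a) := by
  simp only [regBraket, braket]
  exact Finset.sum_comm

/-- Unitarity, in the adjoint form that moves a circuit across the scalar product. -/
theorem SymGate.regBraket_act (G : SymGate N k) (Φ Ψ : RegState N k) :
    regBraket Φ (G.act Ψ) = regBraket (G.inv.act Φ) Ψ := by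
  cases G with
  | aux j U =>
    exact Finset.sum_congr rfl fun c _ => braket_onQubit j U.1 (Φ c) (Ψ c)
  | global U =>
    rw [regBraket_eq_sum_slices, regBraket_eq_sum_slices]
    exact Finset.sum_congr rfl fun a _ => braket_onEach U.1 _ _
  | geometric t θ φ χ =>
    refine Finset.sum_congr rfl fun c _ => Finset.sum_congr rfl fun a _ => ?_
    simp only [SymGate.inv, SymGate.act, star_mul', ← star_geoPhase, star_star]
    ring

/-- The inverse of a list of symmetric gates. -/
def invSym (p : List (SymGate N k)) : List (SymGate N k) := (p.map SymGate.inv).reverse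

theorem length_invSym (p : List (SymGate N k)) : (invSym p).length = p.length := by
  simp [invSym]

theorem runSym_invSym_cons (G : SymGate N k) (p : List (SymGate N k)) (Φ : RegState N k) :
    runSym (invSym (G :: p)) Φ = G.inv.act (runSym (invSym p) Φ) := by
  simp [invSym, runSym]

theorem runSym_runSym_invSym (p : List (SymGate N k)) (Φ : RegState N k) :
    runSym p (runSym (invSym p) Φ) = Φ := by
  induction p with
  | nil => rfl
  | cons G p ih => rw [runSym_invSym_cons, runSym_cons, SymGate.act_inv_act, ih]

theorem runSym_invSym_runSym (p : List (SymGate N k)) (Φ : RegState N k) :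
    runSym (invSym p) (runSym p Φ) = Φ := by
  induction p generalizing Φ with
  | nil => rfl
  | cons G p ih =>
    rw [runSym_invSym_cons, runSym_cons, ih]
    have := G.inv.act_inv_act Φ
    rwa [SymGate.inv_inv] at this

theorem regBraket_runSym (p : List (SymGate N k)) (Φ Ψ : RegState N k) :
    regBraket (runSym p Φ) Ψ = regBraket Φ (runSym (invSym p) Ψ) := by
  induction p generalizing Φ with
  | nil => rfl
  | cons G p ih =>
    rw [runSym_invSym_cons, runSym_cons, ih, SymGate.regBraket_act, SymGate.inv_inv]

/-- Linearity in the shape that reflections `v - 2⟨u, v⟩u` require. -/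
theorem SymGate.act_sub_smul (G : SymGate N k) (Φ Ψ : RegState N k) (z : ℂ) :
    G.act (Φ - z • Ψ) = G.act Φ - z • G.act Ψ := by
  cases G with
  | aux j U =>
    funext c a
    simp only [SymGate.act, onQubit, Pi.sub_apply, Pi.smul_apply, smul_eq_mul, mul_sub,
      Finset.sum_sub_distrib, Finset.mul_sum]
    congr 1
    exact Finset.sum_congr rfl fun b _ => by ring
  | global U =>
    funext c a
    simp only [SymGate.act, onEach_finRange_apply, Pi.sub_apply, Pi.smul_apply, smul_eq_mul,
      mul_sub, Finset.sum_sub_distrib, Finset.mul_sum]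
    congr 1
    exact Finset.sum_congr rfl fun b _ => by ring
  | geometric t θ φ χ =>
    funext c a
    simp only [SymGate.act, Pi.sub_apply, Pi.smul_apply, smul_eq_mul]
    ring

theorem runSym_sub_smul (p : List (SymGate N k)) (Φ Ψ : RegState N k) (z : ℂ) :
    runSym p (Φ - z • Ψ) = runSym p Φ - z • runSym p Ψ := by
  induction p generalizing Φ Ψ with
  | nil => rfl
  | cons G p ih => simp only [runSym_cons, SymGate.act_sub_smul, ih]

theorem SymGate.continuous_act (G : SymGate N k) : Continuous G.act := by
  cases G with
  | aux j U =>
    exact continuous_pi fun c => (continuous_onQubit j U.1).comp (continuous_apply c)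
  | global U =>
    refine continuous_pi fun c => continuous_pi fun a => ?_
    simp only [SymGate.act, onEach_finRange_apply]
    fun_prop
  | geometric t θ φ χ =>
    refine continuous_pi fun c => continuous_pi fun a => ?_
    simp only [SymGate.act]
    fun_prop

/-- Invariance under permutations of the code qubits. -/
def PermInvariant (Φ : RegState N k) : Prop :=
  ∀ (σ : Equiv.Perm (Fin N)) (c : Fin N → Fin 2) (a : Fin k → Fin 2), Φ (c ∘ σ) a = Φ c a

theorem SymGate.permInvariant_act (G : SymGate N k) {Φ : RegState N k} (h : PermInvariant Φ) :
    PermInvariant (G.act Φ) := by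
  intro σ c a
  cases G with
  | aux j U => simp only [SymGate.act, onQubit, h σ c]
  | global U => simp only [SymGate.act, onEach_comp_perm, h σ]
  | geometric t θ φ χ => simp only [SymGate.act, geoPhase, hammingWt_comp_perm, h σ c a]

theorem permInvariant_runSym (p : List (SymGate N k)) {Φ : RegState N k} (h : PermInvariant Φ) :
    PermInvariant (runSym p Φ) := by
  induction p generalizing Φ with
  | nil => exact h
  | cons G p ih => exact ih (G.permInvariant_act h)

theorem PermInvariant.eq_of_hammingWt_eq {Φ : RegState N k} (h : PermInvariant Φ)
    {c c' : Fin N → Fin 2} (hc : hammingWt c = hammingWt c') (a : Fin k → Fin 2) :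
    Φ c a = Φ c' a := by
  obtain ⟨σ, rfl⟩ := exists_perm_of_hammingWt_eq hc
  exact (h σ c a).symm

/-- Exact implementation of arbitrary phases that depend on an integer weight below `M` by `M`
geometric phase gates. -/
theorem exists_runSym_eq_phase (M κ : ℕ) (ν : Fin k → ℕ) (f : ℕ → ℝ)
    (hM : ∀ (c : Fin N → Fin 2) (a : Fin k → Fin 2),
      κ * hammingWt c + ∑ j, ν j * (a j : ℕ) < M) :
    ∃ p : List (SymGate N k), p.length = M ∧ ∀ Φ : RegState N k,
      runSym p Φ = fun c a =>
        Complex.exp (Complex.I * (f (κ * hammingWt c + ∑ j, ν j * (a j : ℕ)) : ℝ)) * Φ c a := by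
  obtain ⟨χ, hχ⟩ := exists_sum_cos_eq M f
  -- The offset `π/2` turns the sine into a cosine, and the negated strength cancels the minus sign
  -- in the exponent of the gate.
  let G : ℕ → SymGate N k := fun i => .geometric (i * (Real.pi / M) * κ)
    (fun j => i * (Real.pi / M) * ν j) (Real.pi / 2) (-χ i)
  refine ⟨(List.range M).map G, by simp, fun Φ => ?_⟩
  have key : ∀ (m : ℕ), runSym ((List.range m).map G) Φ = fun c a =>
      Complex.exp (Complex.I * ((∑ i ∈ Finset.range m, χ i * Real.cos (i * (Real.pi / M *
        ((κ * hammingWt c + ∑ j, ν j * (a j : ℕ) : ℕ) : ℝ))) : ℝ) : ℂ)) * Φ c a := by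
    intro m
    induction m with
    | zero => funext c a; simp [runSym]
    | succ m ih =>
      rw [List.range_succ, List.map_append, runSym_append, ih]
      funext c a
      simp only [List.map_cons, List.map_nil, runSym, List.foldl_cons, List.foldl_nil, G,
        SymGate.act, geoPhase]
      rw [← mul_assoc, ← Complex.exp_add, Finset.sum_range_succ, add_comm (Real.pi / 2),
        Real.sin_add_pi_div_two]
      congr 2
      have harg : (m * (Real.pi / M) * κ * (hammingWt c : ℝ) +
          ∑ j, m * (Real.pi / M) * ν j * ((a j : ℕ) : ℝ)) = m * (Real.pi / M *
        ((κ * hammingWt c + ∑ j, ν j * (a j : ℕ) : ℕ) : ℝ)) := by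
        push_cast
        rw [mul_add, mul_add, Finset.mul_sum, Finset.mul_sum]
        congr 1
        · ring
        · exact Finset.sum_congr rfl fun j _ => by ring
      rw [harg]
      push_cast
      ring
  rw [key]
  funext c a
  rw [hχ _ (hM c a)]

end SymGate

/-! ### States that can be approximated by short circuits -/

section Reach

variable {N k : ℕ}

/-- All code and auxiliary qubits in `|0⟩`. -/
def zeroReg (N k : ℕ) : RegState N k := withZeroAux k (allZero N)

/-- The gate is not a one-qubit gate on the auxiliary qubit `flag`. -/
def SymGate.Avoids (flag : Fin k) : SymGate N k → Prop
  | .aux j _ => j ≠ flag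
  | _ => True

/-- The states that at most `L` symmetric gates avoiding `flag` can prepare. -/
def Reach (N : ℕ) {k : ℕ} (flag : Fin k) (L : ℕ) : Set (RegState N k) :=
  {Φ | ∃ p : List (SymGate N k), p.length ≤ L ∧ (∀ G ∈ p, G.Avoids flag) ∧
    runSym p (zeroReg N k) = Φ}

variable {flag : Fin k} {L : ℕ} {Φ : RegState N k}

theorem act_mem_reach {G : SymGate N k} (hG : G.Avoids flag) (h : Φ ∈ Reach N flag L) :
    G.act Φ ∈ Reach N flag (L + 1) := by
  obtain ⟨p, hp, hpa, rfl⟩ := h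
  refine ⟨p ++ [G], by simpa using hp, ?_, by rw [runSym_append]; rfl⟩
  intro G' hG'
  rcases List.mem_append.1 hG' with h | h
  · exact hpa G' h
  · rw [List.mem_singleton.1 h]
    exact hG

theorem zeroReg_mem_closure_reach : zeroReg N k ∈ closure (Reach N flag 0) :=
  subset_closure ⟨[], by simp, by simp, rfl⟩

theorem closure_reach_mono {L L' : ℕ} (h : L ≤ L') :
    closure (Reach N flag L) ⊆ closure (Reach N flag L') :=
  closure_mono fun _ ⟨p, hp, hp'⟩ => ⟨p, hp.trans h, hp'⟩

theorem act_mem_closure_reach {G : SymGate N k} (hG : G.Avoids flag)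
    (h : Φ ∈ closure (Reach N flag L)) : G.act Φ ∈ closure (Reach N flag (L + 1)) :=
  map_mem_closure G.continuous_act h fun _ => act_mem_reach hG

theorem onEach_mem_closure_reach (U : Matrix.unitaryGroup (Fin 2) ℂ)
    (h : Φ ∈ closure (Reach N flag L)) :
    (fun c a => onEach (List.finRange N) U.1 (fun c' => Φ c' a) c : RegState N k) ∈
      closure (Reach N flag (L + 1)) :=
  act_mem_closure_reach (G := .global U) trivial h

theorem dist_exp_I_mul_le (x y : ℝ) :
    dist (Complex.exp (Complex.I * x)) (Complex.exp (Complex.I * y)) ≤ |x - y| := by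
  have h : Complex.exp (Complex.I * x) - Complex.exp (Complex.I * y) =
      Complex.exp (Complex.I * y) * (Complex.exp (Complex.I * (x - y : ℝ)) - 1) := by
    rw [mul_sub, ← Complex.exp_add, mul_one]
    congr 2
    push_cast
    ring
  rw [dist_eq_norm, h, norm_mul, mul_comm Complex.I (y : ℂ), Complex.norm_exp_ofReal_mul_I, one_mul]
  exact Real.norm_exp_I_mul_ofReal_sub_one_le

/-- Single geometric phase gates approximate all diagonal unitaries that are invariant under
permutations of the code qubits. -/
theorem phase_mem_closure_geoPhase (f : ℕ → (Fin k → Fin 2) → ℝ) :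
    (fun c a => Complex.exp (Complex.I * (f (hammingWt c) a : ℝ)) : RegState N k) ∈
      closure {P : RegState N k | ∃ t θ φ χ, P = geoPhase t θ φ χ} := by
  have hpos : 0 < 2 ^ k := by positivity
  rw [Metric.mem_closure_iff]
  intro ε hε
  -- The label `w + (N+1)v`, with `v` spelled in binary by the auxiliary bits, determines both
  -- weight and auxiliary string, and it is a linear form in the bits. Its exponentially many values
  -- cost nothing, since one gate treats them all.
  obtain ⟨χ, θ, h⟩ := exists_mul_cos_near ((N + 1) * 2 ^ k) (fun s => f (s % (N + 1))
    (finFunctionFinEquiv.symm ⟨s / (N + 1) % 2 ^ k, Nat.mod_lt _ hpos⟩)) (ε / 2) (half_pos hε)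
  refine ⟨_, ⟨θ, fun j => θ * ((N + 1) * 2 ^ (j : ℕ)), Real.pi / 2, -χ, rfl⟩, ?_⟩
  refine lt_of_le_of_lt ((dist_pi_le_iff (half_pos hε).le).2 fun c =>
    (dist_pi_le_iff (half_pos hε).le).2 fun a => ?_) (half_lt_self hε)
  set w := hammingWt c with hw
  have hwN : w < N + 1 := Nat.lt_succ_of_le (hammingWt_le c)
  set v : ℕ := ((finFunctionFinEquiv a : Fin (2 ^ k)) : ℕ) with hv
  have hvk : v < 2 ^ k := (finFunctionFinEquiv a).2
  have hs : w + (N + 1) * v < (N + 1) * 2 ^ k := by nlinarith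
  obtain ⟨m, hm⟩ := h _ hs
  have hmod : (w + (N + 1) * v) % (N + 1) = w := by
    rw [Nat.add_mul_mod_self_left, Nat.mod_eq_of_lt hwN]
  have hdiv : (w + (N + 1) * v) / (N + 1) % 2 ^ k = v := by
    rw [Nat.add_mul_div_left _ _ (Nat.succ_pos N), Nat.div_eq_of_lt hwN, zero_add,
      Nat.mod_eq_of_lt hvk]
  have harg : finFunctionFinEquiv.symm ⟨(w + (N + 1) * v) / (N + 1) % 2 ^ k,
      Nat.mod_lt _ hpos⟩ = a := by
    rw [Equiv.symm_apply_eq]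
    exact Fin.ext hdiv
  simp only [hmod] at hm
  rw [harg] at hm
  have hgeo : geoPhase θ (fun j => θ * ((N + 1) * 2 ^ (j : ℕ))) (Real.pi / 2) (-χ) c a =
      Complex.exp (Complex.I *
        ((χ * Real.cos (((w + (N + 1) * v : ℕ) : ℝ) * θ) - m * (2 * Real.pi) : ℝ) : ℂ)) := by
    have hsum : θ * (hammingWt c : ℝ) + ∑ j : Fin k, θ * ((N + 1) * 2 ^ (j : ℕ)) * ((a j : ℕ) : ℝ) =
        ((w + (N + 1) * v : ℕ) : ℝ) * θ := by
      rw [hv, finFunctionFinEquiv_apply, hw]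
      push_cast
      rw [add_mul, mul_comm θ, Finset.mul_sum, Finset.sum_mul]
      congr 1
      exact Finset.sum_congr rfl fun j _ => by ring
    rw [geoPhase, hsum, add_comm (Real.pi / 2), Real.sin_add_pi_div_two]
    rw [Complex.exp_eq_exp_iff_exists_int]
    exact ⟨m, by push_cast; ring⟩
  rw [hgeo]
  refine (dist_exp_I_mul_le _ _).trans ?_
  rw [abs_sub_comm, show χ * Real.cos (((w + (N + 1) * v : ℕ) : ℝ) * θ) - m * (2 * Real.pi) -
    f w a = χ * Real.cos (((w + (N + 1) * v : ℕ) : ℝ) * θ) - f w a - m * (2 * Real.pi) by ring]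
  exact hm.le

/-- Pointwise multiplication is jointly continuous, so phase and state may be approximated
simultaneously. -/
theorem phase_mem_closure_reach (f : ℕ → (Fin k → Fin 2) → ℝ)
    (h : Φ ∈ closure (Reach N flag L)) :
    (fun c a => Complex.exp (Complex.I * (f (hammingWt c) a : ℝ)) * Φ c a : RegState N k) ∈
      closure (Reach N flag (L + 1)) := by
  refine map_mem_closure₂ (f := fun (P Φ : RegState N k) => (fun c a => P c a * Φ c a)) ?_
    (phase_mem_closure_geoPhase f) h ?_
  · simp only [Function.uncurry_def]
    fun_prop
  · rintro _ ⟨t, θ, φ, χ, rfl⟩ Ψ hΨ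
    exact act_mem_reach (G := .geometric t θ φ χ) trivial hΨ

/-! ### Controlled operations on one auxiliary qubit -/

/-- The Hadamard gate as a unitary. -/
def hadamardU : Matrix.unitaryGroup (Fin 2) ℂ := ⟨hadamardMat, hadamardMat_mem⟩

/-- The matrix `|0⟩⟨0| - i |1⟩⟨1|`. -/
def phaseInvMat : Matrix (Fin 2) (Fin 2) ℂ := !![1, 0; 0, -Complex.I]

theorem phaseInvMat_mem : phaseInvMat ∈ Matrix.unitaryGroup (Fin 2) ℂ := by
  rw [Matrix.mem_unitaryGroup_iff]
  ext i j
  fin_cases i <;> fin_cases j <;>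
    simp [phaseInvMat, Matrix.mul_apply, Fin.sum_univ_two, Matrix.star_apply]

theorem sqrt_two_inv_mul_self :
    ((Real.sqrt 2 : ℝ) : ℂ)⁻¹ * ((Real.sqrt 2 : ℝ) : ℂ)⁻¹ = 1 / 2 := by
  rw [← mul_inv, ← Complex.ofReal_mul, Real.mul_self_sqrt (by norm_num)]
  norm_num

theorem fin_two_eq_zero_or_one (b : Fin 2) : b = 0 ∨ b = 1 := by
  fin_cases b <;> simp

/-- A rotation of one auxiliary qubit in `|0⟩` by an angle that depends on the others. -/
theorem rotation_mem_closure_reach {j : Fin k} (hj : j ≠ flag) (α : (Fin k → Fin 2) → ℝ)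
    (h : Φ ∈ closure (Reach N flag L)) (hΦ : ∀ c a, a j = 1 → Φ c a = 0) :
    (fun c a => ((if a j = 0 then Real.cos (α (Function.update a j 0))
        else Real.sin (α (Function.update a j 0)) : ℝ) : ℂ) * Φ c (Function.update a j 0) :
        RegState N k) ∈ closure (Reach N flag (L + 3)) := by
  -- The phases `exp(±iα)` between Hadamard gates give `cos α|0⟩ + i sin α|1⟩`. The factor `i` is
  -- removed by `phaseInvMat`, merged with the second Hadamard, hence three gates.
  have h3 := act_mem_closure_reach
    (G := .aux j (⟨phaseInvMat, phaseInvMat_mem⟩ * hadamardU)) hj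
    (phase_mem_closure_reach
      (fun _ a => if a j = 0 then α (Function.update a j 0) else -α (Function.update a j 0))
      (act_mem_closure_reach (G := .aux j hadamardU) hj h))
  convert h3 using 1
  funext c a
  have h1 : Φ c (Function.update a j 1) = 0 := hΦ _ _ (by simp)
  simp only [SymGate.act, onQubit, Fin.sum_univ_two, Function.update_self, Function.update_idem,
    h1, hadamardU, Submonoid.coe_mul, Matrix.mul_apply, if_true, mul_zero, add_zero,
    one_ne_zero, if_false, Complex.ofReal_neg, mul_neg]
  set A := α (Function.update a j 0)
  set x := Φ c (Function.update a j 0)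
  have hs := sqrt_two_inv_mul_self
  set r := ((Real.sqrt 2 : ℝ) : ℂ)⁻¹ with hr
  have hc : Complex.cos A = (Complex.exp (Complex.I * A) + Complex.exp (-(Complex.I * A))) / 2 := by
    rw [Complex.cos, mul_comm Complex.I, neg_mul]
  have hsn : Complex.sin A =
      -Complex.I * ((Complex.exp (Complex.I * A) - Complex.exp (-(Complex.I * A))) / 2) := by
    rw [Complex.sin, mul_comm Complex.I, neg_mul]
    ring
  rcases fin_two_eq_zero_or_one (a j) with haj | haj
  · simp [haj, phaseInvMat, hadamardMat, hc, ← hr]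
    linear_combination (-(Complex.exp (Complex.I * A) + Complex.exp (-(Complex.I * A))) * x) * hs
  · simp [haj, phaseInvMat, hadamardMat, hsn, ← hr]
    linear_combination (Complex.I * (Complex.exp (Complex.I * A) - Complex.exp (-(Complex.I * A)))
      * x) * hs

/-- Flipping one auxiliary qubit depending on the weight of the code qubits. -/
theorem flip_mem_closure_reach {j : Fin k} (hj : j ≠ flag) (β : ℕ → Fin 2)
    (h : Φ ∈ closure (Reach N flag L)) :
    (fun c a => Φ c (Function.update a j (a j + β (hammingWt c))) : RegState N k) ∈
      closure (Reach N flag (L + 3)) := by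
  -- A controlled sign flip becomes a controlled bit-flip under conjugation by Hadamard gates.
  have h3 := act_mem_closure_reach (G := .aux j hadamardU) hj
    (phase_mem_closure_reach (fun w a => if a j = 1 ∧ β w = 1 then Real.pi else 0)
      (act_mem_closure_reach (G := .aux j hadamardU) hj h))
  convert h3 using 1
  funext c a
  simp only [SymGate.act, onQubit, Fin.sum_univ_two, Function.update_self, Function.update_idem,
    hadamardU]
  set x₀ := Φ c (Function.update a j 0)
  set x₁ := Φ c (Function.update a j 1)
  have hs := sqrt_two_inv_mul_self
  set r := ((Real.sqrt 2 : ℝ) : ℂ)⁻¹ with hr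
  have hexp : Complex.exp (Complex.I * Real.pi) = -1 := by
    rw [mul_comm, Complex.exp_pi_mul_I]
  rcases fin_two_eq_zero_or_one (a j) with haj | haj <;>
    rcases fin_two_eq_zero_or_one (β (hammingWt c)) with hβ | hβ
  · simp [haj, hβ, hadamardMat, ← hr]
    linear_combination (-2 * x₀) * hs
  · simp [haj, hβ, hadamardMat, ← hr, hexp]
    linear_combination (-2 * x₁) * hs
  · simp [haj, hβ, hadamardMat, ← hr]
    linear_combination (-2 * x₁) * hs
  · simp [haj, hβ, hadamardMat, ← hr, hexp]
    linear_combination (-2 * x₀) * hs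

end Reach

/-! ### Amplitude amplification of a Dicke state from a product state -/

section Coin

variable {N : ℕ}

/-- The rotation `H exp(i τ |1⟩⟨1|) H` of every code qubit. -/
def coinOp (τ : ℝ) (ψ : QState (Fin N)) : QState (Fin N) :=
  onEach (List.finRange N) hadamardMat fun x =>
    Complex.exp (Complex.I * (τ * hammingWt x : ℝ)) * onEach (List.finRange N) hadamardMat ψ x

/-- The product state obtained by rotating every code qubit. -/
def coinState (N : ℕ) (τ : ℝ) : QState (Fin N) := coinOp τ (allZero N)

/-- The sign flip of the basis vectors of weight `w`. -/
def markWt (w : ℕ) (ψ : QState (Fin N)) : QState (Fin N) := fun x =>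
  (if hammingWt x = w then -1 else 1) * ψ x

/-- One round of amplitude amplification. -/
def ampRound (τ : ℝ) (w : ℕ) (ψ : QState (Fin N)) : QState (Fin N) :=
  coinOp τ (markWt 0 (coinOp (-τ) (markWt w ψ)))

theorem star_hadamardMat : star hadamardMat = hadamardMat := by
  ext i j
  fin_cases i <;> fin_cases j <;> simp [hadamardMat, Matrix.star_apply]

theorem hadamardMat_mul_self : hadamardMat * hadamardMat = 1 := by
  have h := Matrix.mem_unitaryGroup_iff.1 hadamardMat_mem
  rwa [star_hadamardMat] at h

theorem onEach_sub_smul (U : Matrix (Fin 2) (Fin 2) ℂ) (φ ψ : QState (Fin N)) (z : ℂ) :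
    onEach (List.finRange N) U (φ - z • ψ) =
      onEach (List.finRange N) U φ - z • onEach (List.finRange N) U ψ := by
  funext x
  simp only [onEach_finRange_apply, Pi.sub_apply, Pi.smul_apply, smul_eq_mul, mul_sub,
    Finset.sum_sub_distrib, Finset.mul_sum]
  congr 1
  exact Finset.sum_congr rfl fun b _ => by ring

theorem coinOp_sub_smul (τ : ℝ) (φ ψ : QState (Fin N)) (z : ℂ) :
    coinOp τ (φ - z • ψ) = coinOp τ φ - z • coinOp τ ψ := by
  rw [coinOp, coinOp, coinOp, ← onEach_sub_smul, onEach_sub_smul]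
  congr 1
  funext x
  simp only [Pi.sub_apply, Pi.smul_apply, smul_eq_mul]
  ring

theorem exp_I_mul_mul_exp_neg (x : ℝ) :
    Complex.exp (Complex.I * x) * Complex.exp (Complex.I * (-x : ℝ)) = 1 := by
  rw [← Complex.exp_add, ← Complex.exp_zero]
  congr 1
  push_cast
  ring

theorem star_exp_I_mul (x : ℝ) :
    star (Complex.exp (Complex.I * x)) = Complex.exp (Complex.I * (-x : ℝ)) := by
  simp only [Complex.star_def, ← Complex.exp_conj, map_mul, Complex.conj_I, Complex.conj_ofReal]
  congr 1
  push_cast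
  ring

theorem coinOp_coinOp_neg (τ : ℝ) (ψ : QState (Fin N)) : coinOp τ (coinOp (-τ) ψ) = ψ := by
  rw [coinOp, coinOp, onEach_mul, hadamardMat_mul_self, onEach_one]
  have : (fun x => Complex.exp (Complex.I * (τ * hammingWt x : ℝ)) *
      (Complex.exp (Complex.I * (-τ * hammingWt x : ℝ)) *
        onEach (List.finRange N) hadamardMat ψ x)) = onEach (List.finRange N) hadamardMat ψ := by
    funext x
    rw [← mul_assoc, neg_mul, exp_I_mul_mul_exp_neg, one_mul]
  rw [this, onEach_mul, hadamardMat_mul_self, onEach_one]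

theorem braket_coinOp (τ : ℝ) (φ ψ : QState (Fin N)) :
    braket φ (coinOp τ ψ) = braket (coinOp (-τ) φ) ψ := by
  rw [coinOp, coinOp, braket_onEach, star_hadamardMat]
  conv_rhs => rw [← star_hadamardMat, ← braket_onEach]
  refine Finset.sum_congr rfl fun x _ => ?_
  rw [star_mul', star_exp_I_mul, star_hadamardMat]
  simp only [neg_mul, neg_neg]
  ring

theorem braket_allZero (ψ : QState (Fin N)) : braket (allZero N) ψ = ψ 0 := by
  rw [braket, Finset.sum_eq_single 0]
  · simp [allZero]
  · intro x _ hx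
    have : ¬ ∀ i, x i = 0 := fun h => hx (funext h)
    simp [allZero, this]
  · simp

theorem braket_coinState_self (τ : ℝ) : braket (coinState N τ) (coinState N τ) = 1 := by
  have h := coinOp_coinOp_neg (-τ) (allZero N)
  rw [neg_neg] at h
  rw [coinState, ← neg_neg τ, ← braket_coinOp, neg_neg, h, braket_allZero]
  simp [allZero]

theorem markWt_zero (ψ : QState (Fin N)) : markWt 0 ψ = ψ - (2 * ψ 0) • allZero N := by
  funext x
  by_cases h : ∀ i, x i = 0
  · have hx : x = 0 := funext h
    subst hx
    simp [markWt, allZero, hammingWt_eq_zero]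
    ring
  · simp [markWt, allZero, hammingWt_eq_zero, h]

/-- Conjugating the reflection along the zero vector by the unitary that creates the coin state
gives the reflection along the coin state. -/
theorem coin_reflection (τ : ℝ) (v : QState (Fin N)) :
    coinOp τ (markWt 0 (coinOp (-τ) v)) =
      v - (2 * braket (coinState N τ) v) • coinState N τ := by
  rw [markWt_zero, coinOp_sub_smul, coinOp_coinOp_neg, ← braket_allZero (coinOp (-τ) v),
    braket_coinOp, neg_neg]
  rfl

theorem coinState_apply (τ : ℝ) (x : Fin N → Fin 2) :
    coinState N τ x = ∏ i, if x i = 0 then (1 + Complex.exp (Complex.I * τ)) / 2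
      else (1 - Complex.exp (Complex.I * τ)) / 2 := by
  have h0 : allZero N = fun x => ∏ i, if x i = 0 then (1 : ℂ) else 0 := by
    funext x
    rw [allZero, Finset.prod_ite_zero]
    simp
  have hexp : ∀ x : Fin N → Fin 2, Complex.exp (Complex.I * (τ * hammingWt x : ℝ)) =
      ∏ i, if x i = 0 then 1 else Complex.exp (Complex.I * τ) := by
    intro x
    have : Complex.I * (τ * hammingWt x : ℝ) = ∑ i, Complex.I * τ * ((x i : ℕ) : ℂ) := by
      rw [← Finset.mul_sum, hammingWt]
      push_cast
      ring
    rw [this, Complex.exp_sum]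
    refine Finset.prod_congr rfl fun i _ => ?_
    rcases fin_two_eq_zero_or_one (x i) with h | h <;> simp [h]
  rw [coinState, coinOp, h0, onEach_prod _ (fun _ b => if b = 0 then (1 : ℂ) else 0)]
  simp only [hexp, ← Finset.prod_mul_distrib]
  rw [onEach_prod _ (fun _ b => (if b = 0 then 1 else Complex.exp (Complex.I * τ)) *
    ∑ d, hadamardMat b d * if d = 0 then 1 else 0)]
  refine Finset.prod_congr rfl fun i _ => ?_
  have hs := sqrt_two_inv_mul_self
  rcases fin_two_eq_zero_or_one (x i) with h | h
  · simp [h, hadamardMat, Fin.sum_univ_two]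
    linear_combination (1 + Complex.exp (Complex.I * τ)) * hs
  · simp [h, hadamardMat, Fin.sum_univ_two]
    linear_combination (1 - Complex.exp (Complex.I * τ)) * hs

theorem prod_ite_eq_pow_hammingWt {R : Type*} [CommMonoid R] (x : Fin N → Fin 2) (y z : R) :
    (∏ i, if x i = 0 then y else z) = y ^ (N - hammingWt x) * z ^ hammingWt x := by
  have hnot : ∀ i, (¬ x i = 0) ↔ x i = 1 := fun i => by
    rcases fin_two_eq_zero_or_one (x i) with h | h <;> simp [h]
  have hcard := Finset.card_filter_add_card_filter_not (s := (Finset.univ : Finset (Fin N)))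
    (p := fun i => x i = 0)
  rw [Finset.prod_ite, Finset.prod_const, Finset.prod_const]
  simp only [hnot, ← hammingWt_eq_card, Finset.card_univ, Fintype.card_fin] at hcard ⊢
  rw [show (Finset.univ.filter fun i => x i = 0).card = N - hammingWt x by omega]

/-- The mode of a binomial distribution with integral mean. -/
theorem binomial_le_mode {N w : ℕ} (hw : w ≤ N) {j : ℕ} (hj : j ≤ N) :
    N.choose j * w ^ j * (N - w) ^ (N - j) ≤ N.choose w * w ^ w * (N - w) ^ (N - w) := by
  set b : ℕ → ℕ := fun j => N.choose j * w ^ j * (N - w) ^ (N - j) with hb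
  -- Consecutive terms have ratio `(N-j)w : (j+1)(N-w)`. Extracting the common factor `K` avoids a
  -- division by zero at `w = N`.
  have hcross : ∀ j, j < N → ∃ K, b j * (j + 1) = K * ((j + 1) * (N - w)) ∧
      b (j + 1) * (j + 1) = K * ((N - j) * w) := by
    intro j hj
    refine ⟨N.choose j * w ^ j * (N - w) ^ (N - (j + 1)), ?_, ?_⟩
    · simp only [hb]
      rw [show N - j = N - (j + 1) + 1 by omega, pow_succ]
      ring
    · simp only [hb]
      have h := Nat.choose_succ_right_eq N j
      calc _ = (N.choose (j + 1) * (j + 1)) * w ^ (j + 1) * (N - w) ^ (N - (j + 1)) := by ring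
        _ = _ := by rw [h]; ring
  have hup : ∀ j, j + 1 ≤ w → b j ≤ b (j + 1) := by
    intro j hjw
    obtain ⟨K, h1, h2⟩ := hcross j (by omega)
    refine le_of_mul_le_mul_right ?_ (Nat.succ_pos j)
    rw [h1, h2]
    refine Nat.mul_le_mul_left _ ?_
    calc (j + 1) * (N - w) ≤ w * (N - j) := Nat.mul_le_mul hjw (by omega)
      _ = (N - j) * w := mul_comm _ _
  have hdown : ∀ j, w ≤ j → j < N → b (j + 1) ≤ b j := by
    intro j hwj hjN
    obtain ⟨K, h1, h2⟩ := hcross j hjN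
    refine le_of_mul_le_mul_right ?_ (Nat.succ_pos j)
    rw [h1, h2]
    refine Nat.mul_le_mul_left _ ?_
    calc (N - j) * w ≤ (N - w) * (j + 1) := Nat.mul_le_mul (by omega) (by omega)
      _ = (j + 1) * (N - w) := mul_comm _ _
  change b j ≤ b w
  rcases le_total j w with h | h
  · obtain ⟨d, rfl⟩ := Nat.exists_eq_add_of_le h
    have : ∀ e, e ≤ d → b j ≤ b (j + e) := by
      intro e
      induction e with
      | zero => intro _; exact le_rfl
      | succ e ih => exact fun he => (ih (by omega)).trans (hup _ (by omega))
    exact this d le_rfl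
  · obtain ⟨d, rfl⟩ := Nat.exists_eq_add_of_le h
    have : ∀ e, e ≤ d → b (w + e) ≤ b w := by
      intro e
      induction e with
      | zero => intro _; exact le_rfl
      | succ e ih => exact fun he => (hdown (w + e) (by omega) (by omega)).trans (ih (by omega))
    exact this d le_rfl

/-- The binomial expansion of `(w + (N-w))^N` has `N + 1` terms, none larger than the mode. -/
theorem pow_self_le_mode {N w : ℕ} (hw : w ≤ N) :
    N ^ N ≤ (N + 1) * (N.choose w * w ^ w * (N - w) ^ (N - w)) := by
  have h := add_pow w (N - w) N
  rw [Nat.add_sub_cancel' hw] at h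
  conv_lhs => rw [h]
  calc _ ≤ ∑ _j ∈ Finset.range (N + 1), N.choose w * w ^ w * (N - w) ^ (N - w) := by
        refine Finset.sum_le_sum fun j hj => ?_
        refine le_trans (le_of_eq ?_) (binomial_le_mode hw (Nat.lt_succ_iff.1 (Finset.mem_range.1 hj)))
        simp only [Nat.cast_id]
        ring
    _ = _ := by simp

/-- The probability of weight `w` in a coin state. -/
def weightProb (N : ℕ) (τ : ℝ) (w : ℕ) : ℝ :=
  ∑ x : Fin N → Fin 2 with hammingWt x = w, Complex.normSq (coinState N τ x)

theorem normSq_coinState (τ : ℝ) (x : Fin N → Fin 2) :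
    Complex.normSq (coinState N τ x) =
      ((1 + Real.cos τ) / 2) ^ (N - hammingWt x) * ((1 - Real.cos τ) / 2) ^ hammingWt x := by
  have he : Complex.exp (Complex.I * τ) = ⟨Real.cos τ, Real.sin τ⟩ := by
    apply Complex.ext
    · rw [mul_comm, Complex.exp_ofReal_mul_I_re]
    · rw [mul_comm, Complex.exp_ofReal_mul_I_im]
  have hsc := Real.sin_sq_add_cos_sq τ
  rw [coinState_apply, map_prod, ← prod_ite_eq_pow_hammingWt]
  refine Finset.prod_congr rfl fun i _ => ?_
  split_ifs
  · rw [map_div₀, he, Complex.normSq_apply, Complex.normSq_ofNat]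
    simp
    linear_combination (1 / 4) * hsc
  · rw [map_div₀, he, Complex.normSq_apply, Complex.normSq_ofNat]
    simp
    linear_combination (1 / 4) * hsc

theorem weightProb_eq (τ : ℝ) {w : ℕ} {x : Fin N → Fin 2} (hx : hammingWt x = w) :
    weightProb N τ w = N.choose w * Complex.normSq (coinState N τ x) := by
  rw [weightProb, Finset.sum_congr rfl (g := fun _ => Complex.normSq (coinState N τ x)),
    Finset.sum_const, card_hammingWt_eq, nsmul_eq_mul]
  intro y hy
  rw [normSq_coinState, normSq_coinState, (Finset.mem_filter.1 hy).2, hx]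

/-- The bits of a coin state are independent, each equal to 1 with probability `(1 - cos τ)/2`.
Making this `w/N` turns `w` into the mode of the weight, whose probability is at least the average
over `N + 1` weights. -/
theorem exists_weightProb_ge {w : ℕ} (hN : 1 ≤ N) (hw : w ≤ N) :
    ∃ τ : ℝ, 1 / ((N : ℝ) + 1) ≤ weightProb N τ w := by
  have hN0 : (0 : ℝ) < N := by exact_mod_cast hN
  have hwN : (w : ℝ) / N ≤ 1 := by rw [div_le_one hN0]; exact_mod_cast hw
  have hw0 : (0 : ℝ) ≤ (w : ℝ) / N := by positivity
  refine ⟨Real.arccos (1 - 2 * (w / N)), ?_⟩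
  have hx : hammingWt (fun i : Fin N => if (i : ℕ) < w then (1 : Fin 2) else 0) = w := by
    rw [hammingWt_eq_card]
    simp [Fin.card_filter_val_lt, hw]
  rw [weightProb_eq _ hx, normSq_coinState, hx, Real.cos_arccos (by linarith) (by linarith)]
  have h := pow_self_le_mode hw
  have h' : (N : ℝ) ^ N ≤ (N + 1) * (N.choose w * w ^ w * (N - w) ^ (N - w)) := by
    have := (Nat.cast_le (α := ℝ)).2 h
    push_cast [Nat.cast_sub hw] at this
    exact this
  have hsplit : (N : ℝ) ^ N = N ^ (N - w) * N ^ w := by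
    rw [← pow_add, Nat.sub_add_cancel hw]
  have hrw : (N.choose w : ℝ) * (((1 + (1 - 2 * ((w : ℝ) / N))) / 2) ^ (N - w) *
      ((1 - (1 - 2 * ((w : ℝ) / N))) / 2) ^ w) =
      N.choose w * w ^ w * (N - w) ^ (N - w) / N ^ N := by
    rw [show (1 + (1 - 2 * ((w : ℝ) / N))) / 2 = (N - w) / N by field_simp; ring,
      show (1 - (1 - 2 * ((w : ℝ) / N))) / 2 = w / N by ring, div_pow, div_pow, hsplit]
    field_simp
  rw [hrw, div_le_div_iff₀ (by positivity) (by positivity)]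
  linarith

theorem exists_angle_of_weightProb (hN : 1 ≤ N) {w : ℕ} (hw : w ≤ N) :
    ∃ τ θ : ℝ, 0 < θ ∧ θ ≤ Real.pi / 2 ∧ weightProb N τ w = Real.sin θ ^ 2 ∧
      1 / ((N : ℝ) + 1) ≤ Real.sin θ ^ 2 := by
  obtain ⟨τ, hτ⟩ := exists_weightProb_ge hN hw
  have hpos : 0 < weightProb N τ w := lt_of_lt_of_le (by positivity) hτ
  have hle : weightProb N τ w ≤ 1 := by
    have h1 : ∑ x, Complex.normSq (coinState N τ x) = 1 := by
      have h := braket_coinState_self (N := N) τ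
      simp only [braket, Complex.star_def, ← Complex.normSq_eq_conj_mul_self] at h
      exact_mod_cast h
    rw [← h1]
    exact Finset.sum_le_sum_of_subset_of_nonneg (Finset.filter_subset _ _)
      fun _ _ _ => Complex.normSq_nonneg _
  have hsq : Real.sqrt (weightProb N τ w) ≤ 1 := Real.sqrt_le_one.2 hle
  have hsin : Real.sin (Real.arcsin (Real.sqrt (weightProb N τ w))) ^ 2 = weightProb N τ w := by
    rw [Real.sin_arcsin (by linarith [Real.sqrt_nonneg (weightProb N τ w)]) hsq,
      Real.sq_sqrt hpos.le]
  exact ⟨τ, Real.arcsin (Real.sqrt (weightProb N τ w)), Real.arcsin_pos.2 (Real.sqrt_pos.2 hpos),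
    Real.arcsin_le_pi_div_two _, hsin.symm, hsin.symm ▸ hτ⟩

/-- The state after some rounds of amplitude amplification. -/
theorem iterate_ampRound {τ θ : ℝ} {w : ℕ} (hθ : weightProb N τ w = Real.sin θ ^ 2) (t : ℕ) :
    ∃ α γ : ℝ, α * Real.sin θ = (-1) ^ t * Real.sin ((2 * t + 1) * θ) ∧
      γ * Real.cos θ = (-1) ^ t * Real.cos ((2 * t + 1) * θ) ∧
      ∀ x, (ampRound τ w)^[t] (coinState N τ) x =
        ((if hammingWt x = w then α else γ : ℝ) : ℂ) * coinState N τ x := by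
  -- A round acts on the weight-`w` part and the rest of the coin state as a rotation by `2θ`, up to
  -- sign; `(-1)^t` appears because the reflection used is `1 - 2|u⟩⟨u|` and not its negative. The
  -- products with `sin θ` and `cos θ` avoid division, as `cos θ` may vanish.
  induction t with
  | zero => exact ⟨1, 1, by simp, by simp, by simp⟩
  | succ t ih =>
    obtain ⟨α, γ, hα, hγ, hv⟩ := ih
    set u := coinState N τ with hu
    set s := Real.sin θ
    set c := Real.cos θ
    have hsc : s ^ 2 + c ^ 2 = 1 := Real.sin_sq_add_cos_sq θ
    have hI : braket u (markWt w ((ampRound τ w)^[t] u)) = ((-α * s ^ 2 + γ * c ^ 2 : ℝ) : ℂ) := by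
      have h1 : ∑ x, Complex.normSq (u x) = 1 := by
        have h := braket_coinState_self (N := N) τ
        simp only [braket, Complex.star_def, ← Complex.normSq_eq_conj_mul_self] at h
        exact_mod_cast h
      have h2 := Finset.sum_filter_add_sum_filter_not (Finset.univ : Finset (Fin N → Fin 2))
        (fun x => hammingWt x = w) (fun x => Complex.normSq (u x))
      have h3 : ∑ x : Fin N → Fin 2 with ¬ hammingWt x = w, Complex.normSq (u x) = c ^ 2 := by
        rw [h1] at h2
        change weightProb N τ w + _ = 1 at h2
        rw [hθ] at h2
        linarith
      have h4 : ∀ x, star (u x) * markWt w ((ampRound τ w)^[t] u) x =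
          (((if hammingWt x = w then -α else γ) * Complex.normSq (u x) : ℝ) : ℂ) := by
        intro x
        rw [markWt, hv]
        push_cast
        rw [Complex.normSq_eq_conj_mul_self, Complex.star_def]
        split_ifs <;> push_cast <;> ring
      rw [braket, Finset.sum_congr rfl fun x _ => h4 x, ← Complex.ofReal_sum]
      congr 1
      simp only [ite_mul]
      rw [Finset.sum_ite, ← Finset.mul_sum, ← Finset.mul_sum, h3]
      change -α * weightProb N τ w + _ = _
      rw [hθ]
    set I := -α * s ^ 2 + γ * c ^ 2 with hIdef
    refine ⟨-α - 2 * I, γ - 2 * I, ?_, ?_, fun x => ?_⟩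
    · rw [show (2 * ((t + 1 : ℕ) : ℝ) + 1) * θ = (2 * t + 1) * θ + 2 * θ by push_cast; ring,
        Real.sin_add, Real.cos_two_mul, Real.sin_two_mul, pow_succ]
      linear_combination (-2 * c ^ 2 + 1) * hα - 2 * s * c * hγ + (2 * α * s) * hsc
    · rw [show (2 * ((t + 1 : ℕ) : ℝ) + 1) * θ = (2 * t + 1) * θ + 2 * θ by push_cast; ring,
        Real.cos_add, Real.cos_two_mul, Real.sin_two_mul, pow_succ]
      linear_combination (1 - 2 * c ^ 2) * hγ + 2 * s * c * hα
    · rw [Function.iterate_succ_apply', ampRound, coin_reflection, ← hu, hI]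
      simp only [Pi.sub_apply, Pi.smul_apply, smul_eq_mul, markWt, hv]
      split_ifs <;> push_cast <;> ring

theorem normSq_iterate_ampRound {τ θ : ℝ} {w : ℕ} (hθ : weightProb N τ w = Real.sin θ ^ 2)
    (t : ℕ) {x : Fin N → Fin 2} (hx : hammingWt x = w) :
    N.choose w * Complex.normSq ((ampRound τ w)^[t] (coinState N τ) x) =
      Real.sin ((2 * t + 1) * θ) ^ 2 := by
  obtain ⟨α, γ, hα, -, hv⟩ := iterate_ampRound hθ t
  have hp := weightProb_eq τ hx
  rw [hθ] at hp
  rw [hv, if_pos hx, Complex.normSq_mul, Complex.normSq_ofReal]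
  have h1 : ((-1 : ℝ) ^ t) ^ 2 = 1 := by rw [← pow_mul, mul_comm, pow_mul]; simp
  calc _ = (α * Real.sin θ) ^ 2 := by rw [mul_pow, hp]; ring
    _ = _ := by rw [hα, mul_pow, h1, one_mul]

/-- If `θ < π/4`, the angles `(2T+1)θ` advance by less than `π/2`, so the first one to reach `π/4`
does not exceed `3π/4`. Since `θ ≥ sin θ ≥ sin² θ ≥ 1/(N+1)`, this happens by `T = N + 1`. -/
theorem exists_rounds {θ : ℝ} (h0 : 0 < θ) (h1 : θ ≤ Real.pi / 2)
    (hs : 1 / ((N : ℝ) + 1) ≤ Real.sin θ ^ 2) :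
    ∃ T ≤ N + 1, 1 / 2 ≤ Real.sin ((2 * (T : ℝ) + 1) * θ) ^ 2 := by
  have hpi := Real.pi_pos
  have key : ∀ y : ℝ, Real.pi / 4 ≤ y → y ≤ 3 * Real.pi / 4 → 1 / 2 ≤ Real.sin y ^ 2 := by
    intro y hy1 hy2
    have h : Real.cos (2 * y) ≤ 0 :=
      Real.cos_nonpos_of_pi_div_two_le_of_le (by linarith) (by linarith)
    rw [Real.cos_two_mul] at h
    have := Real.sin_sq_add_cos_sq y
    linarith
  by_cases hθ : Real.pi / 4 ≤ θ
  · exact ⟨0, by simp, key _ (by simpa using hθ) (by simp; linarith)⟩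
  · push Not at hθ
    have hN1 : (0 : ℝ) < (N : ℝ) + 1 := by positivity
    have hsinpos : 0 < Real.sin θ := Real.sin_pos_of_pos_of_lt_pi h0 (by linarith)
    have hθN : 1 / ((N : ℝ) + 1) ≤ θ := by
      have h2 : Real.sin θ ^ 2 ≤ Real.sin θ := by nlinarith [Real.sin_le_one θ]
      exact hs.trans (h2.trans (Real.sin_le h0.le))
    have hex : ∃ T : ℕ, Real.pi / 4 ≤ (2 * (T : ℝ) + 1) * θ := by
      refine ⟨N + 1, ?_⟩
      rw [div_le_iff₀ hN1] at hθN
      push_cast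
      nlinarith [Real.pi_le_four]
    classical
    have hT := Nat.find_spec hex
    set T := Nat.find hex with hTdef
    refine ⟨T, ?_, key _ hT ?_⟩
    · refine Nat.find_min' hex ?_
      rw [div_le_iff₀ hN1] at hθN
      push_cast
      nlinarith [Real.pi_le_four]
    · rcases Nat.eq_zero_or_pos T with h | h
      · rw [h]; simp; linarith
      · have hlt := Nat.find_min hex (m := T - 1) (by omega)
        push Not at hlt
        rw [Nat.cast_sub h] at hlt
        push_cast at hlt
        nlinarith

end Coin

/-! ### Approximate preparation of permutation-invariant states -/

section Approx

variable {N k : ℕ} {flag : Fin k} {L : ℕ} {Φ : RegState N k}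

/-- The argument of `√x + i√y` serves, including the case `x = y = 0`. -/
theorem exists_angle_sqrt {x y : ℝ} (hx : 0 ≤ x) (hy : 0 ≤ y) :
    ∃ α : ℝ, Real.cos α * Real.sqrt (x + y) = Real.sqrt x ∧
      Real.sin α * Real.sqrt (x + y) = Real.sqrt y := by
  have hn : ‖(⟨Real.sqrt x, Real.sqrt y⟩ : ℂ)‖ = Real.sqrt (x + y) := by
    rw [Complex.norm_def, Complex.normSq_mk, Real.mul_self_sqrt hx, Real.mul_self_sqrt hy]
  refine ⟨Complex.arg ⟨Real.sqrt x, Real.sqrt y⟩, ?_, ?_⟩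
  · rw [← hn, mul_comm, Complex.norm_mul_cos_arg]
  · rw [← hn, mul_comm, Complex.norm_mul_sin_arg]

/-- The amplitude after the qubits in `s` have been prepared according to the marginal of `p`. -/
def marginalAmp (p : (Fin k → Fin 2) → ℝ) (s : Finset (Fin k)) (a : Fin k → Fin 2) : ℝ :=
  if ∀ i, i ∉ s → a i = 0 then
    Real.sqrt (∑ z : Fin k → Fin 2 with ∀ i ∈ s, z i = a i, p z) else 0

/-- The angle splits a marginal probability according to bit `j`. Evaluating it with bit `j` reset
makes it a legitimate control by the other qubits. -/
theorem exists_marginalAmp_insert (p : (Fin k → Fin 2) → ℝ) (hp : ∀ a, 0 ≤ p a)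
    {s : Finset (Fin k)} {j : Fin k} (hj : j ∉ s) :
    ∃ α : (Fin k → Fin 2) → ℝ, ∀ a, marginalAmp p (insert j s) a =
      (if a j = 0 then Real.cos (α (Function.update a j 0))
        else Real.sin (α (Function.update a j 0))) * marginalAmp p s (Function.update a j 0) := by
  set S : (Fin k → Fin 2) → Fin 2 → ℝ := fun a b =>
    ∑ z : Fin k → Fin 2 with (∀ i ∈ s, z i = a i) ∧ z j = b, p z with hS
  have hS0 : ∀ a b, 0 ≤ S a b := fun a b => Finset.sum_nonneg fun z _ => hp z
  choose α hα1 hα2 using fun a => exists_angle_sqrt (hS0 a 0) (hS0 a 1)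
  refine ⟨α, fun a => ?_⟩
  have hne : ∀ i ∈ s, i ≠ j := fun i hi h => hj (h ▸ hi)
  set a' := Function.update a j 0 with ha'
  have ha'i : ∀ i, i ≠ j → a' i = a i := fun i hi => Function.update_of_ne hi _ _
  by_cases h : ∀ i, i ∉ insert j s → a i = 0
  · have h' : ∀ i, i ∉ s → a' i = 0 := by
      intro i hi
      rcases eq_or_ne i j with rfl | hij
      · simp [ha']
      · rw [ha'i i hij]
        exact h i (by simp [hij, hi])
    have hsum : ∑ z : Fin k → Fin 2 with ∀ i ∈ s, z i = a' i, p z = S a' 0 + S a' 1 := by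
      rw [← Finset.sum_filter_add_sum_filter_not _ (fun z : Fin k → Fin 2 => z j = 0),
        Finset.filter_filter, Finset.filter_filter]
      congr 1
      refine Finset.sum_congr (Finset.filter_congr fun z _ => ?_) fun _ _ => rfl
      rcases fin_two_eq_zero_or_one (z j) with hz | hz <;> simp [hz]
    have hins : ∑ z : Fin k → Fin 2 with ∀ i ∈ insert j s, z i = a i, p z = S a' (a j) := by
      refine Finset.sum_congr (Finset.filter_congr fun z _ => ?_) fun _ _ => rfl
      rw [Finset.forall_mem_insert, and_comm]
      refine and_congr_left fun _ => forall₂_congr fun i hi => ?_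
      rw [ha'i i (hne i hi)]
    rw [marginalAmp, marginalAmp, if_pos h, if_pos h', hins, hsum]
    rcases fin_two_eq_zero_or_one (a j) with hz | hz
    · rw [hz, if_pos rfl, hα1]
    · rw [hz, if_neg one_ne_zero, hα2]
  · have h' : ¬ ∀ i, i ∉ s → a' i = 0 := by
      intro h'
      refine h fun i hi => ?_
      simp only [Finset.mem_insert, not_or] at hi
      rw [← ha'i i hi.1]
      exact h' i hi.2
    rw [marginalAmp, marginalAmp, if_neg h, if_neg h', mul_zero]

/-- The distribution is loaded qubit by qubit: each qubit is rotated by its conditional probability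
given the earlier ones, at three gates apiece. -/
theorem marginalAmp_mem_closure_reach (p : (Fin k → Fin 2) → ℝ) (hp : ∀ a, 0 ≤ p a)
    (hp1 : ∑ a, p a = 1) (s : Finset (Fin k)) (hs : flag ∉ s) :
    (fun c a => (marginalAmp p s a : ℂ) * allZero N c : RegState N k) ∈
      closure (Reach N flag (3 * s.card)) := by
  induction s using Finset.induction_on with
  | empty =>
    rw [Finset.card_empty, mul_zero]
    convert zeroReg_mem_closure_reach (N := N) (flag := flag) using 1
    funext c a
    by_cases h : a = 0
    · subst h
      simp [zeroReg, withZeroAux, marginalAmp, hp1]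
    · have h' : ¬ ∀ i, a i = 0 := fun h' => h (funext h')
      simp [zeroReg, withZeroAux, marginalAmp, h, h']
  | insert j s hj ih =>
    have hfs : flag ∉ s := fun h => hs (Finset.mem_insert_of_mem h)
    have hjf : j ≠ flag := fun h => hs (h ▸ Finset.mem_insert_self j s)
    obtain ⟨α, hα⟩ := exists_marginalAmp_insert p hp hj
    have h := rotation_mem_closure_reach hjf α (ih hfs) (by
      intro c a ha
      have : ¬ ∀ i, i ∉ s → a i = 0 := fun h => by
        have := h j hj
        rw [ha] at this
        exact one_ne_zero this
      rw [marginalAmp, if_neg this]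
      simp)
    rw [Finset.card_insert_of_notMem hj, mul_add, mul_one]
    convert h using 1
    funext c a
    rw [hα]
    push_cast
    ring

theorem sqrt_mem_closure_reach (p : (Fin k → Fin 2) → ℝ) (hp : ∀ a, 0 ≤ p a)
    (hp1 : ∑ a, p a = 1) (hflag : ∀ a, a flag = 1 → p a = 0) :
    (fun c a => (Real.sqrt (p a) : ℂ) * allZero N c : RegState N k) ∈
      closure (Reach N flag (3 * k)) := by
  have h := marginalAmp_mem_closure_reach (N := N) (flag := flag) p hp hp1
    (Finset.univ.erase flag) (by simp)
  refine closure_reach_mono ?_ (?_ : _ ∈ closure (Reach N flag (3 * (Finset.univ.erase flag).card)))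
  · refine Nat.mul_le_mul_left 3 ((Finset.card_le_univ _).trans (by simp))
  convert h using 1
  funext c a
  congr 2
  have hoff : (∀ i, i ∉ Finset.univ.erase flag → a i = 0) ↔ a flag = 0 := by simp
  rw [marginalAmp]
  simp only [hoff]
  split_ifs with h0
  · congr 1
    -- On the support of `p` the flag bit is zero, so the other bits determine the string.
    rw [Finset.sum_filter, Finset.sum_eq_single a]
    · simp
    · intro z _ hz
      rcases fin_two_eq_zero_or_one (z flag) with hzf | hzf
      · rw [if_neg]
        intro h
        refine hz (funext fun i => ?_)
        rcases eq_or_ne i flag with rfl | hi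
        · rw [hzf, h0]
        · exact h i (by simp [hi])
      · simp [hflag z hzf]
    · simp
  · have h1 : a flag = 1 := (fin_two_eq_zero_or_one _).resolve_left h0
    rw [hflag a h1, Real.sqrt_zero]

theorem coinOp_mem_closure_reach (τ : (Fin k → Fin 2) → ℝ) (h : Φ ∈ closure (Reach N flag L)) :
    (fun c a => coinOp (τ a) (fun c' => Φ c' a) c : RegState N k) ∈
      closure (Reach N flag (L + 3)) :=
  onEach_mem_closure_reach hadamardU
    (phase_mem_closure_reach (fun w a => τ a * w) (onEach_mem_closure_reach hadamardU h))

theorem exp_I_mul_ite_pi (P : Prop) [Decidable P] :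
    Complex.exp (Complex.I * ((if P then Real.pi else 0 : ℝ) : ℂ)) = if P then -1 else 1 := by
  split_ifs
  · rw [mul_comm, Complex.exp_pi_mul_I]
  · simp

/-- A round of amplitude amplification controlled by the auxiliary qubits. -/
theorem ampRound_mem_closure_reach (τ : (Fin k → Fin 2) → ℝ) (W : (Fin k → Fin 2) → ℕ)
    (A : (Fin k → Fin 2) → Prop) [DecidablePred A] (h : Φ ∈ closure (Reach N flag L)) :
    (fun c a => if A a then ampRound (τ a) (W a) (fun c' => Φ c' a) c else Φ c a :
      RegState N k) ∈ closure (Reach N flag (L + 8)) := by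
  have h1 := phase_mem_closure_reach (fun w a => if A a ∧ w = W a then Real.pi else 0) h
  have h2 := coinOp_mem_closure_reach (fun a => -τ a) h1
  have h3 := phase_mem_closure_reach (fun w a => if A a ∧ w = 0 then Real.pi else 0) h2
  have h4 := coinOp_mem_closure_reach τ h3
  convert h4 using 1
  funext c a
  simp only [exp_I_mul_ite_pi]
  by_cases hA : A a
  · simp only [hA, true_and, if_true]
    rfl
  · simp only [hA, false_and, if_false, one_mul]
    rw [coinOp_coinOp_neg]

/-- Different register strings need different numbers of rounds; the minimum freezes a branch once
it has had its share. -/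
theorem iterate_ampRound_mem_closure_reach (τ : (Fin k → Fin 2) → ℝ) (W T : (Fin k → Fin 2) → ℕ)
    (h : Φ ∈ closure (Reach N flag L)) (t : ℕ) :
    (fun c a => (ampRound (τ a) (W a))^[min t (T a)] (fun c' => Φ c' a) c : RegState N k) ∈
      closure (Reach N flag (L + 8 * t)) := by
  induction t with
  | zero => simpa using h
  | succ t ih =>
    have h' := ampRound_mem_closure_reach τ W (fun a => t < T a) ih
    rw [mul_add, mul_one, ← add_assoc]
    convert h' using 1
    funext c a
    split_ifs with ht
    · rw [min_eq_left (by omega : t + 1 ≤ T a), min_eq_left ht.le, Function.iterate_succ_apply']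
    · rw [min_eq_right (by omega : T a ≤ t + 1), min_eq_right (by omega : T a ≤ t)]

/-- This clears the register: a copy of the weight's code is added bitwise, which modulo two is also
its subtraction. -/
theorem shift_mem_closure_reach (ι : ℕ → Fin k → Fin 2) (h : Φ ∈ closure (Reach N flag L))
    (s : Finset (Fin k)) (hs : flag ∉ s) :
    (fun c a => Φ c (fun i => if i ∈ s then a i + ι (hammingWt c) i else a i) : RegState N k) ∈
      closure (Reach N flag (L + 3 * s.card)) := by
  induction s using Finset.induction_on with
  | empty => simpa using h
  | insert j s hj ih =>
    have hfs : flag ∉ s := fun h => hs (Finset.mem_insert_of_mem h)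
    have hjf : j ≠ flag := fun h => hs (h ▸ Finset.mem_insert_self j s)
    have h' := flip_mem_closure_reach hjf (fun w => ι w j) (ih hfs)
    rw [Finset.card_insert_of_notMem hj, mul_add, mul_one, ← add_assoc]
    convert h' using 1
    funext c a
    congr 1
    funext i
    rcases eq_or_ne i j with rfl | hij
    · simp [hj]
    · simp [hij]

theorem coinOp_smul (τ : ℝ) (z : ℂ) (ψ : QState (Fin N)) : coinOp τ (z • ψ) = z • coinOp τ ψ := by
  -- The difference `ψ - ψ` plays the zero vector, and homogeneity is linearity at that point with
  -- scalar `-z`.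
  have h0 := coinOp_sub_smul τ ψ ψ 1
  have h := coinOp_sub_smul τ (ψ - (1 : ℂ) • ψ) ψ (-z)
  rw [h0] at h
  simpa using h

theorem ampRound_smul (τ : ℝ) (w : ℕ) (z : ℂ) (ψ : QState (Fin N)) :
    ampRound τ w (z • ψ) = z • ampRound τ w ψ := by
  have hm : ∀ (w : ℕ) (φ : QState (Fin N)), markWt w (z • φ) = z • markWt w φ := by
    intro w φ
    funext x
    simp only [markWt, Pi.smul_apply, smul_eq_mul]
    ring
  rw [ampRound, hm, coinOp_smul, hm, coinOp_smul, ampRound]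

theorem iterate_ampRound_smul (τ : ℝ) (w : ℕ) (z : ℂ) (ψ : QState (Fin N)) (t : ℕ) :
    (ampRound τ w)^[t] (z • ψ) = z • (ampRound τ w)^[t] ψ := by
  induction t with
  | zero => rfl
  | succ t ih => rw [Function.iterate_succ_apply', ih, ampRound_smul, Function.iterate_succ_apply']

/-- One-hot encoding of the weights. -/
def oneHot (N w : ℕ) : Fin (N + 2) → Fin 2 := fun j => if (j : ℕ) = w then 1 else 0

/-- A left inverse of the one-hot encoding. -/
def oneHotInv (a : Fin (N + 2) → Fin 2) : ℕ := ∑ j, (a j : ℕ) * j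

theorem oneHotInv_oneHot {w : ℕ} (hw : w ≤ N) : oneHotInv (oneHot N w) = w := by
  rw [oneHotInv, Finset.sum_eq_single ⟨w, by omega⟩]
  · simp [oneHot]
  · intro j _ hj
    have : (j : ℕ) ≠ w := fun h => hj (Fin.ext h)
    simp [oneHot, this]
  · simp

theorem oneHot_last {w : ℕ} (hw : w ≤ N) : oneHot N w (Fin.last (N + 1)) = 0 := by
  have : N + 1 ≠ w := by omega
  simp [oneHot, this]

/-- A state with a constant fraction of every amplitude of a permutation-invariant state can be
approximated by a linear number of symmetric gates. -/
theorem exists_mem_closure_reach_normSq_ge (hN : 1 ≤ N) (ψ : QState (Fin N))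
    (hψ1 : ∑ c, Complex.normSq (ψ c) = 1)
    (hψ : ∀ c c', hammingWt c = hammingWt c' → ψ c = ψ c') :
    ∃ Φ ∈ closure (Reach N (Fin.last (N + 1)) (14 * N + 23)), ∀ c,
      Complex.normSq (ψ c) / 2 ≤ Complex.normSq (Φ c 0) := by
  -- Values chosen for `w > N` are arbitrary and harmless, because `p` vanishes off the one-hot
  -- strings of the weights `0, …, N`. The last of the `N + 2` auxiliary qubits is the flag and is
  -- left alone.
  choose! τ θ hθ0 hθ1 hθ hθN using fun w (hw : w ≤ N) => exists_angle_of_weightProb hN hw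
  choose! T hTN hT using fun w (hw : w ≤ N) => exists_rounds (hθ0 w hw) (hθ1 w hw) (hθN w hw)
  set p : (Fin (N + 2) → Fin 2) → ℝ := fun a =>
    ∑ c : Fin N → Fin 2 with oneHot N (hammingWt c) = a, Complex.normSq (ψ c) with hp
  have hp0 : ∀ a, 0 ≤ p a := fun a => Finset.sum_nonneg fun c _ => Complex.normSq_nonneg _
  have hp1 : ∑ a, p a = 1 := by
    rw [← hψ1]
    exact Finset.sum_fiberwise _ _ _
  have hpflag : ∀ a, a (Fin.last (N + 1)) = 1 → p a = 0 := by
    intro a ha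
    refine Finset.sum_eq_zero fun c hc => ?_
    have := (Finset.mem_filter.1 hc).2
    rw [← this, oneHot_last (hammingWt_le c)] at ha
    exact absurd ha zero_ne_one
  have hpι : ∀ c : Fin N → Fin 2,
      p (oneHot N (hammingWt c)) = N.choose (hammingWt c) * Complex.normSq (ψ c) := by
    intro c
    have hfil : (Finset.univ.filter fun c' : Fin N → Fin 2 =>
        oneHot N (hammingWt c') = oneHot N (hammingWt c)) =
        Finset.univ.filter fun c' => hammingWt c' = hammingWt c := by
      refine Finset.filter_congr fun c' _ => ⟨fun h => ?_, fun h => by rw [h]⟩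
      rw [← oneHotInv_oneHot (hammingWt_le c'), h, oneHotInv_oneHot (hammingWt_le c)]
    simp only [hp]
    rw [hfil, Finset.sum_congr rfl (g := fun _ => Complex.normSq (ψ c)), Finset.sum_const,
      card_hammingWt_eq, nsmul_eq_mul]
    intro c' hc'
    rw [hψ c' c (Finset.mem_filter.1 hc').2]
  -- The costs are `3(N+2)` for loading the register, `3` for the coin, `8(N+1)` for the rounds and
  -- `3(N+1)` for clearing. After clearing, the zero slice collects the branches whose register
  -- agrees with the weight of the code qubits.
  have h1 := sqrt_mem_closure_reach (N := N) p hp0 hp1 hpflag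
  have h2 := coinOp_mem_closure_reach (fun a => τ (oneHotInv a)) h1
  have h3 := iterate_ampRound_mem_closure_reach (fun a => τ (oneHotInv a)) oneHotInv
    (fun a => T (oneHotInv a)) h2 (N + 1)
  have h4 := shift_mem_closure_reach (oneHot N) h3 (Finset.univ.erase (Fin.last (N + 1))) (by simp)
  refine ⟨_, closure_reach_mono ?_ h4, fun c => ?_⟩
  · simp
    omega
  have hw := hammingWt_le c
  set w := hammingWt c with hwdef
  have harg : (fun i => if i ∈ Finset.univ.erase (Fin.last (N + 1)) then
      (0 : Fin (N + 2) → Fin 2) i + oneHot N w i else (0 : Fin (N + 2) → Fin 2) i) =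
      oneHot N w := by
    funext i
    rcases eq_or_ne i (Fin.last (N + 1)) with rfl | hi
    · simp [oneHot_last hw]
    · simp [hi]
  rw [harg]
  simp only [oneHotInv_oneHot hw]
  have hcoin : (fun c' => coinOp (τ w) (fun c'' : Fin N → Fin 2 =>
      (Real.sqrt (p (oneHot N w)) : ℂ) * allZero N c'') c') =
      (Real.sqrt (p (oneHot N w)) : ℂ) • coinState N (τ w) :=
    coinOp_smul (τ w) _ (allZero N)
  rw [hcoin, iterate_ampRound_smul, min_eq_right (hTN w hw), Pi.smul_apply, smul_eq_mul,
    Complex.normSq_mul, Complex.normSq_ofReal, Real.mul_self_sqrt (hp0 _), hpι, mul_comm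
      (N.choose w : ℝ), mul_assoc, normSq_iterate_ampRound (hθ w hw) _ hwdef.symm]
  have := mul_le_mul_of_nonneg_left (hT w hw) (Complex.normSq_nonneg (ψ c))
  linarith

/-- A linear number of symmetric gates prepares a state with half of every amplitude of a
permutation-invariant state. -/
theorem exists_runSym_norm_ge (hN : 1 ≤ N) (ψ : QState (Fin N))
    (hψ1 : ∑ c, Complex.normSq (ψ c) = 1)
    (hψ : ∀ c c', hammingWt c = hammingWt c' → ψ c = ψ c') :
    ∃ p : List (SymGate N (N + 2)), p.length ≤ 14 * N + 23 ∧
      (∀ G ∈ p, G.Avoids (Fin.last (N + 1))) ∧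
      ∀ c, ‖ψ c‖ / 2 ≤ ‖runSym p (zeroReg N (N + 2)) c 0‖ := by
  obtain ⟨Φ, hΦ, hge⟩ := exists_mem_closure_reach_normSq_ge hN ψ hψ1 hψ
  -- As `1/√2 > 1/2`, strict inequalities hold at the finitely many `c` with `ψ c ≠ 0`. They define
  -- an open set, which therefore contains the state of an actual circuit.
  set V : Set (RegState N (N + 2)) := ⋂ c : {c : Fin N → Fin 2 // ψ c ≠ 0},
    {Φ | ‖ψ c.1‖ / 2 < ‖Φ c.1 0‖} with hV
  have hVo : IsOpen V := by
    refine isOpen_iInter_of_finite fun c => ?_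
    exact isOpen_lt continuous_const (by fun_prop)
  have hmem : Φ ∈ V := by
    refine Set.mem_iInter.2 fun c => ?_
    have h := hge c.1
    rw [Complex.normSq_eq_norm_sq, Complex.normSq_eq_norm_sq] at h
    have hpos : 0 < ‖ψ c.1‖ := norm_pos_iff.2 c.2
    change ‖ψ c.1‖ / 2 < ‖Φ c.1 0‖
    refine lt_of_pow_lt_pow_left₀ 2 (norm_nonneg _) ?_
    nlinarith
  obtain ⟨_, hΨV, p, hp, hpa, rfl⟩ := mem_closure_iff.1 hΦ V hVo hmem
  refine ⟨p, hp, hpa, fun c => ?_⟩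
  by_cases h0 : ψ c = 0
  · rw [h0]
    simp
  · exact (Set.mem_iInter.1 hΨV ⟨c, h0⟩).le

end Approx

/-! ### Exact preparation of permutation-invariant states -/

section Exact

variable {N k : ℕ}

/-- The filter needs the flag to be exactly `|0⟩` after the approximate stage; gates that avoid the
flag are at most diagonal in its bit. -/
theorem SymGate.act_eq_zero_of_flag {flag : Fin k} {G : SymGate N k} (hG : G.Avoids flag)
    {Φ : RegState N k} (h : ∀ c a, a flag = 1 → Φ c a = 0) :
    ∀ c a, a flag = 1 → G.act Φ c a = 0 := by
  intro c a ha
  cases G with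
  | aux j U =>
    change onQubit j U.1 (Φ c) a = 0
    refine Finset.sum_eq_zero fun b _ => ?_
    rw [h c _ (by rwa [Function.update_of_ne (Ne.symm hG)]), mul_zero]
  | global U =>
    simp only [SymGate.act, onEach_finRange_apply, h _ a ha, mul_zero, Finset.sum_const_zero]
  | geometric t θ φ χ => simp only [SymGate.act, h c a ha, mul_zero]

theorem runSym_eq_zero_of_flag {flag : Fin k} (p : List (SymGate N k))
    (hp : ∀ G ∈ p, G.Avoids flag) {Φ : RegState N k} (h : ∀ c a, a flag = 1 → Φ c a = 0) :
    ∀ c a, a flag = 1 → runSym p Φ c a = 0 := by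
  induction p generalizing Φ with
  | nil => exact h
  | cons G p ih =>
    exact ih (fun G' hG' => hp G' (List.mem_cons_of_mem _ hG'))
      (SymGate.act_eq_zero_of_flag (hp G List.mem_cons_self) h)

theorem permInvariant_zeroReg : PermInvariant (zeroReg N k) := by
  intro σ c a
  have : (∀ i, (c ∘ σ) i = 0) ↔ ∀ i, c i = 0 :=
    ⟨fun h i => by simpa using h (σ.symm i), fun h i => h _⟩
  simp only [zeroReg, withZeroAux, allZero, this]

/-- Complex numbers in the unit disc are midpoints of unit complex numbers. -/
theorem exists_midpoint_exp {z : ℂ} (hz : ‖z‖ ≤ 1) :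
    ∃ x y : ℝ, (Complex.exp (Complex.I * x) + Complex.exp (Complex.I * y)) / 2 = z := by
  -- Two unit vectors symmetric about the direction of `z` have midpoint of length the cosine of the
  -- half-angle.
  refine ⟨Complex.arg z + Real.arccos ‖z‖, Complex.arg z - Real.arccos ‖z‖, ?_⟩
  have hcos : Complex.cos (Real.arccos ‖z‖ : ℝ) = (‖z‖ : ℂ) := by
    rw [← Complex.ofReal_cos, Real.cos_arccos (by linarith [norm_nonneg z]) hz]
  have h : (Complex.exp (Complex.I * ((Complex.arg z + Real.arccos ‖z‖ : ℝ) : ℂ)) +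
      Complex.exp (Complex.I * ((Complex.arg z - Real.arccos ‖z‖ : ℝ) : ℂ))) / 2 =
      Complex.exp (Complex.arg z * Complex.I) * Complex.cos (Real.arccos ‖z‖ : ℝ) := by
    rw [Complex.cos, mul_div_assoc', mul_add, ← Complex.exp_add, ← Complex.exp_add]
    congr 3 <;> push_cast <;> ring_nf
  rw [h, hcos, mul_comm, Complex.norm_mul_exp_arg_mul_I]

/-- Multiplication of the amplitudes by a function of the weight, of modulus at most one, in the
branch where an auxiliary qubit `flag` stays in `|0⟩`. -/
theorem exists_runSym_filter (flag : Fin k) (r : ℕ → ℂ) (hr : ∀ w, ‖r w‖ ≤ 1) :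
    ∃ q : List (SymGate N k), q.length = 2 * N + 4 ∧ ∀ Φ : RegState N k,
      (∀ c a, a flag = 1 → Φ c a = 0) → ∀ c, runSym q Φ c 0 = r (hammingWt c) * Φ c 0 := by
  choose x y hxy using fun w => exists_midpoint_exp (hr w)
  have hsum : ∀ a : Fin k → Fin 2,
      ∑ j, (if j = flag then N + 1 else 0) * (a j : ℕ) = (N + 1) * (a flag : ℕ) := by
    intro a
    simp [ite_mul]
  -- Coupling the flag with weight `N + 1` separates its two values: labels up to `N` carry the
  -- phase `x`, the others `y`. The Hadamard gates on the flag average the two phases in the branch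
  -- where it returns to `|0⟩`.
  obtain ⟨q, hq, hqrun⟩ := exists_runSym_eq_phase (N := N) (2 * N + 2) 1
    (fun j => if j = flag then N + 1 else 0)
    (fun s => if s < N + 1 then x s else y (s - (N + 1))) (by
      intro c a
      rw [hsum]
      have := hammingWt_le c
      have := (a flag).2
      nlinarith)
  refine ⟨SymGate.aux flag hadamardU :: (q ++ [SymGate.aux flag hadamardU]), by simp [hq],
    fun Φ hΦ c => ?_⟩
  have hw := hammingWt_le c
  rw [runSym_cons, runSym_append, hqrun]
  simp only [hsum, one_mul, runSym, List.foldl_cons, List.foldl_nil]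
  simp only [SymGate.act, onQubit, Fin.sum_univ_two, Function.update_self, Function.update_idem,
    hΦ c (Function.update 0 flag 1) (by simp), hadamardU]
  have h0 : Function.update (0 : Fin k → Fin 2) flag 0 = 0 := by
    simp
  rw [h0, ← hxy]
  have hs := sqrt_two_inv_mul_self
  have hlt : hammingWt c < N + 1 := by omega
  have hge : ¬ hammingWt c + N + 1 ≤ N := by omega
  simp [hadamardMat, hlt, ← add_assoc, hge]
  linear_combination ((Complex.exp (Complex.I * x (hammingWt c)) +
    Complex.exp (Complex.I * y (hammingWt c))) * Φ c 0) * hs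

/-- The sign flip of the all-zero basis vector of code and auxiliary qubits. -/
theorem exists_runSym_reflect_zeroReg (N k : ℕ) :
    ∃ q : List (SymGate N k), q.length = N + k + 1 ∧ ∀ Φ : RegState N k,
      runSym q Φ = Φ - (2 * Φ 0 0) • zeroReg N k := by
  -- The total weight of code and auxiliary bits vanishes only at the zero string.
  obtain ⟨q, hq, hqrun⟩ := exists_runSym_eq_phase (N := N) (k := k) (N + k + 1) 1 (fun _ => 1)
    (fun s => if s = 0 then Real.pi else 0) (by
      intro c a
      have h1 := hammingWt_le c
      have h2 := hammingWt_le a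
      simp only [hammingWt] at h2
      simp only [one_mul]
      omega)
  refine ⟨q, hq, fun Φ => ?_⟩
  rw [hqrun]
  funext c a
  simp only [exp_I_mul_ite_pi, one_mul, add_eq_zero, hammingWt_eq_zero]
  change (if (∀ i, c i = 0) ∧ hammingWt a = 0 then (-1 : ℂ) else 1) * Φ c a = _
  simp only [hammingWt_eq_zero]
  by_cases hc : c = 0
  · by_cases ha : a = 0
    · subst hc ha
      simp [zeroReg, withZeroAux, allZero]
      ring
    · have : ¬ ∀ i, a i = 0 := fun h => ha (funext h)
      simp [zeroReg, withZeroAux, ha, this]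
  · have : ¬ ∀ i, c i = 0 := fun h => hc (funext h)
    simp [zeroReg, withZeroAux, allZero, this]

/-- The sign flip of all basis vectors with a nonzero auxiliary qubit. -/
theorem exists_runSym_reflect_aux (N k : ℕ) :
    ∃ q : List (SymGate N k), q.length = k + 1 ∧ ∀ Φ : RegState N k,
      runSym q Φ = fun c a => if a = 0 then Φ c a else -Φ c a := by
  obtain ⟨q, hq, hqrun⟩ := exists_runSym_eq_phase (N := N) (k := k) (k + 1) 0 (fun _ => 1)
    (fun s => if ¬ s = 0 then Real.pi else 0) (by
      intro c a
      have h2 := hammingWt_le a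
      simp only [hammingWt] at h2
      simp only [one_mul]
      omega)
  refine ⟨q, hq, fun Φ => ?_⟩
  rw [hqrun]
  funext c a
  simp only [exp_I_mul_ite_pi, one_mul, zero_mul, zero_add]
  change (if ¬ hammingWt a = 0 then (-1 : ℂ) else 1) * Φ c a = _
  simp only [hammingWt_eq_zero]
  have : (∀ i, a i = 0) ↔ a = 0 := funext_iff.symm
  simp only [this]
  split_ifs <;> simp

theorem regBraket_zeroReg (Φ : RegState N k) : regBraket (zeroReg N k) Φ = Φ 0 0 := by
  rw [regBraket_eq_sum_slices, Finset.sum_eq_single 0]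
  · have h : (fun c => zeroReg N k c 0) = allZero N := by
      funext c
      simp [zeroReg, withZeroAux]
    rw [h, braket_allZero]
  · intro a _ ha
    simp [braket, zeroReg, withZeroAux, ha]
  · simp

/-- Exact amplitude amplification: a circuit that prepares a state with amplitude one half
on the auxiliary qubits in `|0⋯0⟩` can be used three times to prepare it with amplitude one. -/
theorem exists_runSym_eq_of_half (G : List (SymGate N k)) (ψ : QState (Fin N))
    (hψ1 : ∑ c, Complex.normSq (ψ c) = 1)
    (hG : ∀ c, runSym G (zeroReg N k) c 0 = ψ c / 2) :
    ∃ p : List (SymGate N k), p.length = 3 * G.length + N + 2 * k + 2 ∧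
      runSym p (zeroReg N k) = withZeroAux k ψ := by
  obtain ⟨q₀, hq₀, hq₀run⟩ := exists_runSym_reflect_zeroReg N k
  obtain ⟨q₁, hq₁, hq₁run⟩ := exists_runSym_reflect_aux N k
  -- Let `Γ` be the output of `G` and `Ψ` the target. Since the zero slice of `Γ` is `Ψ/2`, `q₁`
  -- maps `Γ` to `Ψ - Γ`. The last three blocks form the reflection along `Γ`, and `⟨Γ, Ψ - Γ⟩ = 1/2
  -- - 1 = -1/2`, so it adds `Γ` and leaves `Ψ`.
  refine ⟨G ++ q₁ ++ invSym G ++ q₀ ++ G, by simp [length_invSym, hq₀, hq₁]; ring, ?_⟩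
  rw [runSym_append, runSym_append, runSym_append, runSym_append]
  set Γ := runSym G (zeroReg N k) with hΓ
  have hΓΓ : regBraket Γ Γ = 1 := by
    rw [hΓ, regBraket_runSym, runSym_invSym_runSym, regBraket_zeroReg]
    simp [zeroReg, withZeroAux, allZero]
  have h1 : runSym q₁ Γ = withZeroAux k ψ - (1 : ℂ) • Γ := by
    rw [hq₁run]
    funext c a
    by_cases ha : a = 0
    · subst ha
      simp [withZeroAux, hG]
      ring
    · simp [withZeroAux, ha]
  have hhalf : regBraket Γ (withZeroAux k ψ) = 1 / 2 := by
    rw [regBraket_eq_sum_slices, Finset.sum_eq_single 0]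
    · have : ∀ c, star (Γ c 0) * withZeroAux k ψ c 0 = ((Complex.normSq (ψ c) : ℝ) : ℂ) / 2 := by
        intro c
        rw [hG, Complex.normSq_eq_conj_mul_self]
        simp [withZeroAux]
        ring
      rw [braket, Finset.sum_congr rfl fun c _ => this c, ← Finset.sum_div, ← Complex.ofReal_sum,
        hψ1]
      simp
    · intro a _ ha
      simp [braket, withZeroAux, ha]
    · simp
  have hsub : regBraket Γ (withZeroAux k ψ - (1 : ℂ) • Γ) = -1 / 2 := by
    have : regBraket Γ (withZeroAux k ψ - (1 : ℂ) • Γ) =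
        regBraket Γ (withZeroAux k ψ) - regBraket Γ Γ := by
      simp only [regBraket, braket, Pi.sub_apply, one_smul, mul_sub, Finset.sum_sub_distrib]
    rw [this, hhalf, hΓΓ]
    norm_num
  rw [h1, hq₀run, runSym_sub_smul, runSym_runSym_invSym, 
    ← regBraket_zeroReg (runSym (invSym G) (withZeroAux k ψ - (1 : ℂ) • Γ)),
    ← regBraket_runSym, ← hΓ, hsub]
  funext c a
  simp only [Pi.sub_apply, Pi.smul_apply, smul_eq_mul]
  ring

/-- Every normalised permutation-invariant state of the code qubits can be prepared exactly by a
linear number of gates. -/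
theorem exists_runGates_eq_machineState (hN : 1 ≤ N) (ψ : QState (Fin N))
    (hψ1 : ∑ c, Complex.normSq (ψ c) = 1)
    (hψ : ∀ c c', hammingWt c = hammingWt c' → ψ c = ψ c') :
    ∃ prep : List (Gate N (N + 2)), prep.length ≤ 51 * N + 87 ∧
      ∀ e : Fin 2 → ℂ, runGates prep (machineState (N + 2) e (allZero N)) =
        machineState (N + 2) e ψ := by
  obtain ⟨p, hp, hpa, hpψ⟩ := exists_runSym_norm_ge hN ψ hψ1 hψ
  set Ψ := runSym p (zeroReg N (N + 2)) with hΨ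
  have hinv : PermInvariant Ψ := permInvariant_runSym p permInvariant_zeroReg
  have hflag : ∀ c a, a (Fin.last (N + 1)) = 1 → Ψ c a = 0 := by
    refine runSym_eq_zero_of_flag p hpa fun c a ha => ?_
    have : a ≠ 0 := by
      rintro rfl
      exact zero_ne_one ha
    simp [zeroReg, withZeroAux, this]
  -- Both `ψ` and `Ψ` depend only on the weight, so their quotient does too; the lower bound on `Ψ`
  -- keeps its modulus at most one.
  have hr : ∀ w : ℕ, ∃ r : ℂ, ‖r‖ ≤ 1 ∧ ∀ c, hammingWt c = w → r * Ψ c 0 = ψ c / 2 := by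
    intro w
    by_cases hex : ∃ c : Fin N → Fin 2, hammingWt c = w
    · obtain ⟨c₀, hc₀⟩ := hex
      by_cases h0 : ψ c₀ = 0
      · refine ⟨0, by simp, fun c hc => ?_⟩
        rw [hψ c c₀ (hc.trans hc₀.symm), h0]
        simp
      · have hψpos : 0 < ‖ψ c₀‖ := norm_pos_iff.2 h0
        have hΨpos : 0 < ‖Ψ c₀ 0‖ := lt_of_lt_of_le (by positivity) (hpψ c₀)
        refine ⟨ψ c₀ / 2 / Ψ c₀ 0, ?_, fun c hc => ?_⟩
        · rw [norm_div, norm_div, div_le_one hΨpos]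
          simpa using hpψ c₀
        · rw [hψ c c₀ (hc.trans hc₀.symm), hinv.eq_of_hammingWt_eq (hc.trans hc₀.symm),
            div_mul_cancel₀ _ (norm_pos_iff.1 hΨpos)]
    · exact ⟨0, by simp, fun c hc => absurd ⟨c, hc⟩ hex⟩
  choose r hr1 hrψ using hr
  obtain ⟨q, hq, hqrun⟩ := exists_runSym_filter (N := N) (Fin.last (N + 1)) r hr1
  obtain ⟨P, hP, hPrun⟩ := exists_runSym_eq_of_half (p ++ q) ψ hψ1 (fun c => by
    rw [runSym_append, hqrun _ hflag, hrψ _ c rfl])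
  refine ⟨P.map SymGate.toGate, ?_, fun e => ?_⟩
  · rw [List.length_map, hP, List.length_append, hq]
    omega
  · rw [machineState_eq_withEnc, machineState_eq_withEnc, runGates_map_toGate]
    exact congrArg _ hPrun

end Exact

/-! ### The codewords of shifted gnu codes -/

section Gnu

theorem gnuWord_apply (r g n Δ N : ℕ) (c : Fin N → Fin 2) :
    gnuWord r g n Δ N c = ((Real.sqrt ((2 : ℝ) ^ (-((n : ℤ) - 1))) *
      ∑ j ∈ (Finset.range (n + 1)).filter (fun j => j % 2 = r),
        if hammingWt c = g * j + Δ then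
          Real.sqrt (n.choose j : ℝ) * (1 / Real.sqrt (N.choose (g * j + Δ) : ℝ)) else 0 : ℝ) : ℂ) := by
  simp only [gnuWord, Pi.smul_apply, Finset.sum_apply, smul_eq_mul, dicke]
  push_cast
  congr 1
  refine Finset.sum_congr rfl fun j _ => ?_
  split_ifs <;> simp

theorem gnuWord_eq_of_hammingWt_eq (r g n Δ N : ℕ) {c c' : Fin N → Fin 2}
    (h : hammingWt c = hammingWt c') : gnuWord r g n Δ N c = gnuWord r g n Δ N c' := by
  rw [gnuWord_apply, gnuWord_apply, h]

/-- The alternating sum vanishes, so even and odd indices share `2^n` equally. -/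
theorem sum_even_choose {n : ℕ} (hn : 1 ≤ n) :
    ∑ j ∈ (Finset.range (n + 1)).filter (fun j => j % 2 = 0), (n.choose j : ℝ) =
      2 ^ (n - 1) := by
  have h1 := Finset.sum_filter_add_sum_filter_not (Finset.range (n + 1)) (fun j => j % 2 = 0)
    (fun j => (n.choose j : ℝ))
  have h2 := Finset.sum_filter_add_sum_filter_not (Finset.range (n + 1)) (fun j => j % 2 = 0)
    (fun j => (-1 : ℝ) ^ j * (n.choose j : ℝ))
  have h3 : ∑ j ∈ Finset.range (n + 1), (-1 : ℝ) ^ j * (n.choose j : ℝ) = 0 := by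
    exact_mod_cast Int.alternating_sum_range_choose_of_ne (n := n) (by omega)
  have h4 : ∑ j ∈ Finset.range (n + 1), (n.choose j : ℝ) = 2 ^ n := by
    exact_mod_cast Nat.sum_range_choose n
  have h5 : ∑ j ∈ (Finset.range (n + 1)).filter (fun j => j % 2 = 0),
      (-1 : ℝ) ^ j * (n.choose j : ℝ) =
      ∑ j ∈ (Finset.range (n + 1)).filter (fun j => j % 2 = 0), (n.choose j : ℝ) := by
    refine Finset.sum_congr rfl fun j hj => ?_
    rw [(Nat.even_iff.2 (Finset.mem_filter.1 hj).2).neg_one_pow, one_mul]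
  have h6 : ∑ j ∈ (Finset.range (n + 1)).filter (fun j => ¬ j % 2 = 0),
      (-1 : ℝ) ^ j * (n.choose j : ℝ) =
      -∑ j ∈ (Finset.range (n + 1)).filter (fun j => ¬ j % 2 = 0), (n.choose j : ℝ) := by
    rw [← Finset.sum_neg_distrib]
    refine Finset.sum_congr rfl fun j hj => ?_
    have hodd : Odd j := Nat.odd_iff.2 (by have := (Finset.mem_filter.1 hj).2; omega)
    rw [hodd.neg_one_pow, neg_one_mul]
  rw [h4] at h1
  rw [h3, h5, h6] at h2
  have h7 : (2 : ℝ) ^ n = 2 * 2 ^ (n - 1) := by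
    rw [← pow_succ', Nat.sub_add_cancel hn]
  linarith

/-- As `g ≥ 1`, distinct `j` give distinct weights, so no cross terms occur; the bound on `N` makes
every Dicke state involved nonzero. -/
theorem sum_normSq_gnuZero {g n Δ N : ℕ} (hg : 1 ≤ g) (hn : 1 ≤ n) (hN : g * n + Δ ≤ N) :
    ∑ c, Complex.normSq (gnuZero g n Δ N c) = 1 := by
  set J := (Finset.range (n + 1)).filter (fun j => j % 2 = 0) with hJ
  set K : ℝ := (2 : ℝ) ^ (-((n : ℤ) - 1)) with hK
  have hK0 : 0 ≤ K := by positivity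
  have hsq : ∀ c : Fin N → Fin 2, Complex.normSq (gnuZero g n Δ N c) =
      ∑ j ∈ J, if hammingWt c = g * j + Δ then
        K * ((n.choose j : ℝ) / (N.choose (g * j + Δ) : ℝ)) else 0 := by
    intro c
    rw [gnuZero, gnuWord_apply, Complex.normSq_ofReal, ← hJ, ← hK]
    by_cases hex : ∃ j ∈ J, hammingWt c = g * j + Δ
    · obtain ⟨j, hj, hcj⟩ := hex
      have hne : ∀ i ∈ J, i ≠ j → ¬ hammingWt c = g * i + Δ := by
        intro i _ hij h
        rw [hcj] at h
        exact hij (Nat.eq_of_mul_eq_mul_left hg (by omega))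
      rw [Finset.sum_eq_single j (fun i hi hij => if_neg (hne i hi hij)) (fun h => absurd hj h),
        Finset.sum_eq_single j (fun i hi hij => if_neg (hne i hi hij)) (fun h => absurd hj h),
        if_pos hcj, if_pos hcj]
      have h1 := Real.mul_self_sqrt hK0
      have h2 := Real.mul_self_sqrt (Nat.cast_nonneg (α := ℝ) (n.choose j))
      have h3 := Real.mul_self_sqrt (Nat.cast_nonneg (α := ℝ) (N.choose (g * j + Δ)))
      calc _ = (Real.sqrt K * Real.sqrt K) *
            ((Real.sqrt (n.choose j : ℝ) * Real.sqrt (n.choose j : ℝ)) /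
              (Real.sqrt (N.choose (g * j + Δ) : ℝ) * Real.sqrt (N.choose (g * j + Δ) : ℝ))) := by
            ring
        _ = _ := by rw [h1, h2, h3]
    · push Not at hex
      rw [Finset.sum_eq_zero fun j hj => if_neg (hex j hj),
        Finset.sum_eq_zero fun j hj => if_neg (hex j hj)]
      simp
  rw [Finset.sum_congr rfl fun c _ => hsq c, Finset.sum_comm]
  have hj : ∀ j ∈ J, ∑ c : Fin N → Fin 2, (if hammingWt c = g * j + Δ then
        K * ((n.choose j : ℝ) / (N.choose (g * j + Δ) : ℝ)) else 0) = K * n.choose j := by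
    intro j hj
    have hjn : j ≤ n := Nat.lt_succ_iff.1 (Finset.mem_range.1 (Finset.mem_filter.1 hj).1)
    have hle : g * j + Δ ≤ N := by
      have := Nat.mul_le_mul_left g hjn
      omega
    have hpos : (N.choose (g * j + Δ) : ℝ) ≠ 0 := by
      exact_mod_cast (Nat.choose_pos hle).ne'
    rw [← Finset.sum_filter, Finset.sum_const, card_hammingWt_eq, nsmul_eq_mul]
    field_simp
  rw [Finset.sum_congr rfl hj, ← Finset.mul_sum, hJ, sum_even_choose hn, hK, zpow_neg,
    show ((n : ℤ) - 1) = ((n - 1 : ℕ) : ℤ) by omega, zpow_natCast]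
  exact inv_mul_cancel₀ (by positivity)

/-- Because `ω^g = -1`, the factor `ω^(gj+Δ)` depends only on the parity of `j`: this is the logical
`Z` up to `ω^Δ`. -/
theorem exp_pow_hammingWt_mul_gnuWord {r g n Δ N : ℕ} (hg : 1 ≤ g) (c : Fin N → Fin 2) :
    Complex.exp (Real.pi * Complex.I / g) ^ hammingWt c * gnuWord r g n Δ N c =
      (-1) ^ r * Complex.exp (Real.pi * Complex.I / g) ^ Δ * gnuWord r g n Δ N c := by
  have hg0 : (g : ℂ) ≠ 0 := by exact_mod_cast (by omega : g ≠ 0)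
  have hω : Complex.exp (Real.pi * Complex.I / g) ^ g = -1 := by
    rw [← Complex.exp_nat_mul, mul_div_cancel₀ _ hg0, Complex.exp_pi_mul_I]
  by_cases hex : ∃ j ∈ (Finset.range (n + 1)).filter (fun j => j % 2 = r),
      hammingWt c = g * j + Δ
  · obtain ⟨j, hj, hc⟩ := hex
    have hjr := (Finset.mem_filter.1 hj).2
    have hpar : (-1 : ℂ) ^ j = (-1) ^ r := by
      rw [← hjr, neg_one_pow_eq_pow_mod_two]
    rw [hc, pow_add, pow_mul, hω, hpar]
  · push Not at hex
    have : gnuWord r g n Δ N c = 0 := by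
      rw [gnuWord_apply, Finset.sum_eq_zero fun j hj => if_neg (hex j hj)]
      simp
    rw [this, mul_zero, mul_zero]

end Gnu

/-! ### Gate teleportation -/

section Teleport

variable {N k : ℕ}

theorem branches_map_gate_append (p : List (Gate N k)) (q : List (Step N k)) (c : Fin 2)
    (ψ : QState (Wire N k)) :
    branches (p.map Step.gate ++ q) c ψ = branches q c (runGates p ψ) := by
  induction p generalizing ψ with
  | nil => rfl
  | cons G p ih => exact ih (G.act ψ)

theorem onPair_cnotMat {Q : Type} [DecidableEq Q] (q r : Q) (ψ : QState Q)
    (x : Q → Fin 2) : onPair q r cnotMat ψ x = ψ (Function.update x r (x r + x q)) := by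
  rw [onPair, Finset.sum_eq_single (x q, x r + x q)]
  · have h : ∀ b d : Fin 2, cnotMat (b, d) (b, d + b) = 1 := by
      intro b d
      fin_cases b <;> fin_cases d <;> simp [cnotMat]
    simp [h]
  · intro p _ hp
    have h : ∀ (b d : Fin 2) (p : Fin 2 × Fin 2), p ≠ (b, d + b) → cnotMat (b, d) p = 0 := by
      rintro b d ⟨p, p'⟩
      fin_cases b <;> fin_cases d <;> fin_cases p <;> fin_cases p' <;> simp [cnotMat]
    rw [h _ _ _ hp, zero_mul]
  · simp

/-- The bit string with the code bits in `l` flipped if the bit to be encoded is set. -/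
def flipCode (l : List (Fin N)) (x : Wire N k → Fin 2) : Wire N k → Fin 2 :=
  Sum.elim (fun _ => x (encW N k))
    (Sum.elim (fun i => if i ∈ l then x (codeW k i) + x (encW N k) else x (codeW k i))
      (fun j => x (auxW N j)))

/-- The control is never a target and each target occurs once, so the CNOTs permute basis strings
without interfering. -/
theorem runGates_cnot (l : List (Fin N)) (hl : l.Nodup) (ψ : QState (Wire N k))
    (x : Wire N k → Fin 2) :
    runGates (l.map fun i => Gate.two (encW N k) (codeW k i) (encW_ne_codeW k i)
      ⟨cnotMat, cnotMat_mem⟩) ψ x = ψ (flipCode l x) := by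
  induction l generalizing ψ with
  | nil =>
    refine congrArg ψ (funext fun q => ?_)
    rcases q with _ | i | j <;> simp [flipCode, encW, codeW, auxW]
  | cons i l ih =>
    obtain ⟨hi, hl⟩ := List.nodup_cons.1 hl
    refine (ih hl _).trans ?_
    refine (onPair_cnotMat (encW N k) (codeW k i) _ _).trans (congrArg ψ (funext fun q => ?_))
    rcases q with _ | i' | j
    · simp [flipCode, encW, codeW]
    · rcases eq_or_ne i' i with rfl | h
      · simp [flipCode, encW, codeW, hi]
      · simp [flipCode, encW, codeW, h]
    · simp [flipCode, encW, codeW, auxW]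

theorem branches_map_gateIf (p : List (Gate N k)) (c : Fin 2) (ψ : QState (Wire N k)) :
    branches (p.map Step.gateIf) c ψ = [if c = 1 then runGates p ψ else ψ] := by
  induction p generalizing ψ with
  | nil => simp [branches, runGates]
  | cons G p ih =>
    refine (ih _).trans ?_
    split_ifs <;> rfl

theorem runGates_rotMat (g : ℕ) (l : List (Fin N)) (ψ : QState (Wire N k))
    (x : Wire N k → Fin 2) :
    runGates (l.map fun i => Gate.one (codeW k i) ⟨rotMat g, rotMat_mem g⟩) ψ x =
      Complex.exp (Real.pi * Complex.I / g) ^ (l.map fun i => (x (codeW k i) : ℕ)).sum * ψ x := by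
  induction l generalizing ψ with
  | nil => simp [runGates]
  | cons i l ih =>
    refine (ih _).trans ?_
    have h : onQubit (codeW k i) (rotMat g) ψ x =
        Complex.exp (Real.pi * Complex.I / g) ^ (x (codeW k i) : ℕ) * ψ x := by
      rw [onQubit, Fin.sum_univ_two]
      rcases fin_two_eq_zero_or_one (x (codeW k i)) with hx | hx
      · have : Function.update x (codeW k i) 0 = x := by rw [← hx, Function.update_eq_self]
        simp [hx, rotMat, this]
      · have : Function.update x (codeW k i) 1 = x := by rw [← hx, Function.update_eq_self]
        simp [hx, rotMat, this]
    change _ * onQubit (codeW k i) (rotMat g) ψ x = _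
    rw [h, List.map_cons, List.sum_cons, pow_add]
    ring

theorem length_teleport (g N k : ℕ) : (teleport g N k).length = 2 * N + 2 := by
  simp [teleport]
  ring

/-- Gate teleportation encodes the first qubit. -/
theorem branches_teleport {g n Δ : ℕ} (hg : 1 ≤ g)
    (hX : onEach (List.finRange N) pauliX (gnuZero g n Δ N) = gnuOne g n Δ N) (a b : ℂ) :
    branches (teleport g N k) 0 (machineState k ![a, b] (gnuZero g n Δ N)) =
      [((1 / Real.sqrt 2 : ℝ) : ℂ) •
          machineState k ![1, 0] (a • gnuZero g n Δ N + b • gnuOne g n Δ N),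
        (((1 / Real.sqrt 2 : ℝ) : ℂ) * Complex.exp (Real.pi * Complex.I / g) ^ Δ) •
          machineState k ![0, 1] (a • gnuZero g n Δ N + b • gnuOne g n Δ N)] := by
  set ψ₁ : QState (Wire N k) := fun x =>
    (if x (encW N k) = 0 then a * gnuZero g n Δ N (fun i => x (codeW k i))
      else b * gnuOne g n Δ N (fun i => x (codeW k i))) *
    (if ∀ j : Fin k, x (auxW N j) = 0 then 1 else 0) with hψ₁
  have h1 : runGates ((List.finRange N).map fun i => Gate.two (encW N k) (codeW k i)
      (encW_ne_codeW k i) ⟨cnotMat, cnotMat_mem⟩) (machineState k ![a, b] (gnuZero g n Δ N)) =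
      ψ₁ := by
    funext x
    rw [runGates_cnot _ (List.nodup_finRange N)]
    have hcode : (fun i => flipCode (List.finRange N) x (codeW k i)) =
        fun i => x (codeW k i) + x (encW N k) := by
      funext i
      simp [flipCode, codeW]
    have haux : ∀ j, flipCode (List.finRange N) x (auxW N j) = x (auxW N j) := fun j => rfl
    have henc : flipCode (List.finRange N) x (encW N k) = x (encW N k) := rfl
    simp only [machineState, hcode, haux, henc, hψ₁]
    congr 1
    rcases fin_two_eq_zero_or_one (x (encW N k)) with hx | hx
    · simp [hx]
    · rw [← hX, onEach_pauliX]
      simp [hx]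
  set ψ₂ := onQubit (encW N k) hadamardMat ψ₁ with hψ₂
  have h2 : ∀ x, ψ₂ x = ((1 / Real.sqrt 2 : ℝ) : ℂ) *
      (a * gnuZero g n Δ N (fun i => x (codeW k i)) + (if x (encW N k) = 0 then 1 else -1) *
        (b * gnuOne g n Δ N (fun i => x (codeW k i)))) *
      (if ∀ j : Fin k, x (auxW N j) = 0 then 1 else 0) := by
    intro x
    have hcode : ∀ (d : Fin 2) (i : Fin N),
        Function.update x (encW N k) d (codeW k i) = x (codeW k i) := fun d i =>
      Function.update_of_ne (encW_ne_codeW k i).symm _ _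
    have haux : ∀ (d : Fin 2) (j : Fin k),
        Function.update x (encW N k) d (auxW N j) = x (auxW N j) := fun d j =>
      Function.update_of_ne (by simp [encW, auxW]) _ _
    simp only [hψ₂, onQubit, Fin.sum_univ_two, hψ₁, hcode, haux, Function.update_self, if_true,
      one_ne_zero, if_false]
    rcases fin_two_eq_zero_or_one (x (encW N k)) with hx | hx
    · simp [hx, hadamardMat]
      split_ifs <;> ring
    · simp [hx, hadamardMat]
      split_ifs <;> ring
  have hsplit : teleport g N k = ((List.finRange N).map fun i => Gate.two (encW N k) (codeW k i)
      (encW_ne_codeW k i) ⟨cnotMat, cnotMat_mem⟩).map Step.gate ++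
      (Step.gate (.one (encW N k) ⟨hadamardMat, hadamardMat_mem⟩) :: Step.measure (encW N k) ::
      ((List.finRange N).map fun i => Gate.one (codeW k i) ⟨rotMat g, rotMat_mem g⟩).map
        Step.gateIf) := by
    simp [teleport, Function.comp_def]
  rw [hsplit, branches_map_gate_append, h1]
  change branches _ 0 (projectQubit (encW N k) 0 ψ₂) ++
    branches _ 1 (projectQubit (encW N k) 1 ψ₂) = _
  rw [branches_map_gateIf, branches_map_gateIf, if_neg zero_ne_one, if_pos rfl,
    List.singleton_append]
  congr 1
  · funext x
    simp only [projectQubit, h2, Pi.smul_apply, smul_eq_mul, machineState, Pi.add_apply]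
    rcases fin_two_eq_zero_or_one (x (encW N k)) with hx | hx
    · simp [hx]
    · simp [hx]
  · congr 1
    funext x
    rw [runGates_rotMat]
    have hwt : ((List.finRange N).map fun i => (x (codeW k i) : ℕ)).sum =
        hammingWt fun i => x (codeW k i) := by
      rw [hammingWt, Fin.sum_univ_def]
    have hZ := exp_pow_hammingWt_mul_gnuWord (r := 0) (n := n) (Δ := Δ) hg
      (fun i => x (codeW k i))
    have hO := exp_pow_hammingWt_mul_gnuWord (r := 1) (n := n) (Δ := Δ) hg
      (fun i => x (codeW k i))
    change _ * gnuZero g n Δ N _ = _ * gnuZero g n Δ N _ at hZ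
    change _ * gnuOne g n Δ N _ = _ * gnuOne g n Δ N _ at hO
    rw [hwt]
    simp only [projectQubit, h2, Pi.smul_apply, smul_eq_mul, machineState, Pi.add_apply]
    set e := (if ∀ j : Fin k, x (auxW N j) = 0 then (1 : ℂ) else 0)
    rcases fin_two_eq_zero_or_one (x (encW N k)) with hx | hx
    · simp [hx]
    · simp only [hx, one_ne_zero, if_false, if_true, Matrix.cons_val_one, Matrix.cons_val_zero]
      simp only [pow_zero, pow_one] at hZ hO
      -- Outcome 1 leaves a minus sign at the logical one, which the factor `-1` in `hO` cancels.
      linear_combination (((1 / Real.sqrt 2 : ℝ) : ℂ) * a * e) * hZ -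
        (((1 / Real.sqrt 2 : ℝ) : ℂ) * b * e) * hO

end Teleport

theorem norm_exp_pi_mul_I_div_pow (g Δ : ℕ) :
    ‖Complex.exp (Real.pi * Complex.I / g) ^ Δ‖ = 1 := by
  have h : (Real.pi * Complex.I / g : ℂ) = ((Real.pi / g : ℝ) : ℂ) * Complex.I := by
    push_cast
    ring
  rw [norm_pow, h, Complex.norm_exp_ofReal_mul_I, one_pow]

end

theorem theorem2 :
    ∃ C : ℕ, ∀ (g n Δ N : ℕ) (u : ℚ),
      1 ≤ g → 1 ≤ n → 1 ≤ u → (N : ℚ) = g * n * u + Δ →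
      -- the bit-flip on all qubits is the logical bit-flip of the code
      onEach (List.finRange N) pauliX (gnuZero g n Δ N) = gnuOne g n Δ N →
      onEach (List.finRange N) pauliX (gnuOne g n Δ N) = gnuZero g n Δ N →
      ∃ (k : ℕ) (prep : List (Gate N k)),
        k ≤ C * N ∧
        -- linear-time preparation of the logical zero, whatever the qubit to be encoded
        prep.length ≤ C * N ∧
        (∀ e : Fin 2 → ℂ, runGates prep (machineState k e (allZero N)) =
          machineState k e (gnuZero g n Δ N)) ∧
        -- gate teleportation
        (teleport g N k).length = 2 * N + 2 ∧
        -- preparation followed by teleportation encodes every qubit, in a linear number of steps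
        (prep.map Step.gate ++ teleport g N k).length ≤ C * N ∧
        ∃ γ : ℂ, ‖γ‖ = 1 ∧ ∀ a b : ℂ,
          branches (prep.map Step.gate ++ teleport g N k) 0
              (machineState k ![a, b] (allZero N)) =
            [((1 / Real.sqrt 2 : ℝ) : ℂ) •
                machineState k ![1, 0] (a • gnuZero g n Δ N + b • gnuOne g n Δ N),
              (((1 / Real.sqrt 2 : ℝ) : ℂ) * γ) •
                machineState k ![0, 1] (a • gnuZero g n Δ N + b • gnuOne g n Δ N)] := by
  -- The total is `(51N + 87) + (2N + 2) = 53N + 89`, which is at most `142N` for `N ≥ 1`.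
  refine ⟨142, fun g n Δ N u hg hn hu hN hX _ => ?_⟩
  have hle : g * n + Δ ≤ N := by
    have h : ((g * n + Δ : ℕ) : ℚ) ≤ N := by
      rw [hN]
      push_cast
      have : (g : ℚ) * n ≤ g * n * u := le_mul_of_one_le_right (by positivity) hu
      linarith
    exact_mod_cast h
  have hN1 : 1 ≤ N := by
    have := Nat.mul_pos hg hn
    omega
  obtain ⟨prep, hlen, hprep⟩ := exists_runGates_eq_machineState hN1 (gnuZero g n Δ N)
    (sum_normSq_gnuZero hg hn hle) fun _ _ h => gnuWord_eq_of_hammingWt_eq _ _ _ _ _ h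
  refine ⟨N + 2, prep, by omega, by omega, hprep, length_teleport g N (N + 2), ?_,
    _, norm_exp_pi_mul_I_div_pow g Δ, fun a b => ?_⟩
  · rw [List.length_append, List.length_map, length_teleport]
    omega
  · rw [branches_map_gate_append, hprep]
    exact branches_teleport hg hX a b
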